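/- For $n\ge 0$ let $F\in\mathbb{C}^{2n\times 2n}$ be the unitary DFT matrix, $F_{k,a}=\frac{1}{\sqrt{2n}}e^{-2\pi i ka/(2n)}$ ($0\le k,a<2n$). Let $v=(1,\dots,1,0,\dots,0)\in\mathbb{R}^{2n}$ ($n$ ones followed by $n$ zeros), let $\hat v_k=\sum_{a=0}^{2n-1}v_a e^{-2\pi i ka/(2n)}$ and $\Sigma=\mathrm{diag}(\hat v)$, and let $\sqrt{\Sigma}$ be the entrywise principal square root of this diagonal matrix. Let $E\in\mathbb{R}^{2n\times n}$ embed $\mathbb{R}^n$ as the first $n$ coordinates of $\mathbb{R}^{2n}$. Let $C_F=F^*\sqrt{\Sigma}\,F\,E$ be the (real, $2n\times n$) FFT encoder. Let $S\in\mathbb{R}^{n\times n}$ be the prefix-sum matrix (ones on and below the diagonal, zeros above it), and let $B_{F\mathrm{opt}}=S\,C_F^{\dagger}$, an $n\times 2n$ matrix, be the optimal decoder, where $\dagger$ denotes the Moore--Penrose inverse. Then the map $b\mapsto B_{F\mathrm{opt}}\,b$, $b\in\mathbb{R}^{2n}$, may be evaluated in $O(n\log^2 n)$ time. That is, there is a single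 program for a real RAM which, for every $n$ and every $b\in\mathbb{R}^{2n}$, given $n$ and the entries of $b$ as input, computes the vector $B_{F\mathrm{opt}}\,b$ exactly and halts after at most $T(n)$ steps, where $T(n)=O(n\log^2 n)$ as $n\to\infty$. Here the real RAM performs, at unit cost each: exact real $+,-,\times,\div$, square roots and comparisons, the formation of $\cos(\pi/N)$ and $\sin(\pi/N)$ for a natural number $N$ that it holds, integer constants, addition, truncated subtraction, halving and comparison of natural numbers (counters and addresses), indirect memory access, and control flow (branching, loops, procedure calls). -/

import Mathlib

open Matrix

/-! ## Matrices: DFT, encoder, Moore–Penrose inverse, optimal decoder -/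

namespace FFTMech

/-- The four Penrose equations: `X` is the Moore–Penrose inverse of `A`. -/
structure IsMoorePenrose {m n : Type*} [Fintype m] [Fintype n]
    (A : Matrix m n ℂ) (X : Matrix n m ℂ) : Prop where
  mul_mul_self : A * X * A = A
  self_mul_mul : X * A * X = X
  isHermitian_left : (A * X).IsHermitian
  isHermitian_right : (X * A).IsHermitian

open scoped ComplexOrder in
/-- Every complex matrix has a Moore–Penrose inverse. -/
theorem exists_isMoorePenrose {m n : Type*} [Fintype m] [Fintype n]
    (A : Matrix m n ℂ) : ∃ X : Matrix n m ℂ, IsMoorePenrose A X := by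
  classical
  have hH : (Aᴴ * A).IsHermitian := isHermitian_conjTranspose_mul_self A
  set H := Aᴴ * A with hHdef
  obtain ⟨U, d, hU1, hHU⟩ : ∃ (U : Matrix n n ℂ) (d : n → ℝ),
      Uᴴ * U = 1 ∧ H = U * diagonal (fun i => (d i : ℂ)) * Uᴴ := by
    refine ⟨hH.eigenvectorUnitary, hH.eigenvalues, ?_, ?_⟩
    · exact Unitary.coe_star_mul_self hH.eigenvectorUnitary
    · conv_lhs => rw [hH.spectral_theorem]
      rw [Unitary.conjStarAlgAut_apply]
      rfl
  set D : Matrix n n ℂ := diagonal (fun i => (d i : ℂ)) with hD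
  set E : Matrix n n ℂ := diagonal (fun i => ((d i)⁻¹ : ℂ)) with hE
  have hDE : D * E = E * D := by simp [hD, hE, mul_comm]
  have hDED : D * E * D = D := by
    simp only [hD, hE, diagonal_mul_diagonal]
    congr 1; funext i
    by_cases h : (d i : ℂ) = 0 <;> simp [h]
  have hEDE : E * D * E = E := by
    simp only [hD, hE, diagonal_mul_diagonal]
    congr 1; funext i
    by_cases h : (d i : ℂ) = 0 <;> simp [h]
  have hEh : Eᴴ = E := by
    simp only [hE, diagonal_conjTranspose]
    congr 1; funext i; simp
  set G : Matrix n n ℂ := U * E * Uᴴ with hG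
  have hmul (P Q : Matrix n n ℂ) : (U * P * Uᴴ) * (U * Q * Uᴴ) = U * (P * Q) * Uᴴ := by
    calc (U * P * Uᴴ) * (U * Q * Uᴴ) = U * P * (Uᴴ * U) * Q * Uᴴ := by
          simp only [Matrix.mul_assoc]
      _ = U * (P * Q) * Uᴴ := by rw [hU1]; simp only [Matrix.mul_one, Matrix.mul_assoc]
  have hGH : Gᴴ = G := by
    simp only [hG, conjTranspose_mul, conjTranspose_conjTranspose, hEh, Matrix.mul_assoc]
  have hcomm : H * G = G * H := by rw [hHU, hG, hmul, hmul, hDE]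
  have hHGH : H * G * H = H := by rw [hHU, hG, hmul, hmul, hDED]
  have hGHG : G * H * G = G := by rw [hHU, hG, hmul, hmul, hEDE]
  have hAGH : A * (G * H) = A := by
    have h0 : A * (G * H) - A = 0 := by
      rw [← conjTranspose_mul_self_eq_zero]
      have : (A * (G * H) - A)ᴴ * (A * (G * H) - A)
          = (H * G) * (H * G * H - H) - (H * G * H - H) := by
        simp only [conjTranspose_sub, conjTranspose_mul, hGH, hHdef,
          conjTranspose_conjTranspose]
        simp only [Matrix.sub_mul, Matrix.mul_sub, Matrix.mul_assoc]
      rw [this, hHGH]; simp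
    exact sub_eq_zero.mp h0
  refine ⟨G * Aᴴ, ?_, ?_, ?_, ?_⟩
  · calc A * (G * Aᴴ) * A = A * (G * H) := by simp only [hHdef, Matrix.mul_assoc]
      _ = A := hAGH
  · calc G * Aᴴ * A * (G * Aᴴ) = G * H * G * Aᴴ := by simp only [hHdef, Matrix.mul_assoc]
      _ = G * Aᴴ := by rw [hGHG]
  · simp only [IsHermitian, conjTranspose_mul, conjTranspose_conjTranspose, hGH, Matrix.mul_assoc]
  · have : G * Aᴴ * A = G * H := by simp only [hHdef, Matrix.mul_assoc]
    rw [this, IsHermitian, conjTranspose_mul, hGH, hH.eq, hcomm]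

/-- The Moore–Penrose inverse is unique. -/
theorem IsMoorePenrose.unique {m n : Type*} [Fintype m] [Fintype n]
    {A : Matrix m n ℂ} {X Y : Matrix n m ℂ}
    (hX : IsMoorePenrose A X) (hY : IsMoorePenrose A Y) : X = Y := by
  have h1 : A * X = A * Y := by
    calc A * X = (A * Y * A) * X := by rw [hY.mul_mul_self]
      _ = (A * Y)ᴴ * (A * X)ᴴ := by
          rw [hY.isHermitian_left.eq, hX.isHermitian_left.eq, Matrix.mul_assoc (A * Y)]
      _ = (A * X * A * Y)ᴴ := by rw [← conjTranspose_mul, Matrix.mul_assoc (A * X)]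
      _ = A * Y := by rw [hX.mul_mul_self, hY.isHermitian_left.eq]
  have h2 : X * A = Y * A := by
    calc X * A = X * (A * Y * A) := by rw [hY.mul_mul_self]
      _ = (X * A)ᴴ * (Y * A)ᴴ := by
          rw [hY.isHermitian_right.eq, hX.isHermitian_right.eq]; simp only [Matrix.mul_assoc]
      _ = (Y * (A * X * A))ᴴ := by rw [← conjTranspose_mul]; simp only [Matrix.mul_assoc]
      _ = Y * A := by rw [hX.mul_mul_self, hY.isHermitian_right.eq]
  calc X = X * A * X := hX.self_mul_mul.symm
    _ = Y * A * Y := by rw [h2, Matrix.mul_assoc, h1, ← Matrix.mul_assoc]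
    _ = Y := hY.self_mul_mul

/-- The Moore–Penrose inverse `A†`. -/
noncomputable def pinv {m n : Type*} [Fintype m] [Fintype n] (A : Matrix m n ℂ) : Matrix n m ℂ :=
  Classical.choose (exists_isMoorePenrose A)

theorem pinv_spec {m n : Type*} [Fintype m] [Fintype n] (A : Matrix m n ℂ) :
    IsMoorePenrose A (pinv A) :=
  Classical.choose_spec (exists_isMoorePenrose A)

/-- The unitary DFT matrix of size `N`, with entries `exp (-2πi k a / N) / √N`. -/
noncomputable def dftMatrix (N : ℕ) : Matrix (Fin N) (Fin N) ℂ :=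
  Matrix.of fun k a =>
    ((Real.sqrt N : ℝ) : ℂ)⁻¹ *
      Complex.exp (-(2 * Real.pi * Complex.I * (k : ℂ) * (a : ℂ) / (N : ℂ)))

/-- The (unnormalized) DFT of a vector: `∑ a, v a * exp (-2πi k a / N)`. -/
noncomputable def dftVec {N : ℕ} (v : Fin N → ℂ) (k : Fin N) : ℂ :=
  ∑ a : Fin N, v a * Complex.exp (-(2 * Real.pi * Complex.I * (k : ℂ) * (a : ℂ) / (N : ℂ)))

/-- The vector `(1, …, 1, 0, …, 0)` with `n` ones and `n` zeros: the first column of the circulant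
matrix of size `2n` that extends the prefix-sum matrix. -/
def circVec (n : ℕ) : Fin (2 * n) → ℂ := fun a => if (a : ℕ) < n then 1 else 0

/-- `√Σ`, where `Σ` is the diagonal matrix of the DFT of `circVec n`; `Complex.sqrt` is the
principal square root. -/
noncomputable def sqrtSigma (n : ℕ) : Matrix (Fin (2 * n)) (Fin (2 * n)) ℂ :=
  Matrix.diagonal fun k => Complex.sqrt (dftVec (circVec n) k)

/-- The embedding of `n`-dimensional space as the first `n` of `2n` coordinates. -/
def embedMatrix (n : ℕ) : Matrix (Fin (2 * n)) (Fin n) ℂ :=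
  Matrix.of fun i j => if (i : ℕ) = (j : ℕ) then 1 else 0

/-- The prefix-sum matrix: ones on and below the main diagonal. -/
def prefixSum (n : ℕ) : Matrix (Fin n) (Fin n) ℂ :=
  Matrix.of fun i j => if j ≤ i then 1 else 0

/-- The FFT encoder `C_F = F* √Σ F E`, of shape `2n × n`. (Its entries happen to be real.) -/
noncomputable def encoder (n : ℕ) : Matrix (Fin (2 * n)) (Fin n) ℂ :=
  (dftMatrix (2 * n))ᴴ * (sqrtSigma n * dftMatrix (2 * n) * embedMatrix n)

/-- The optimal decoder `B_Fopt = S C_F†`, of shape `n × 2n`. -/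
noncomputable def optDecoder (n : ℕ) : Matrix (Fin n) (Fin (2 * n)) ℂ :=
  prefixSum n * pinv (encoder n)

end FFTMech

/-! ## The real RAM with unit-cost arithmetic

The machine has natural-number registers and an addressable natural-number memory (for counters,
addresses and stacks), and real registers and an addressable real memory. Every operation, test
and memory access costs one unit. Natural numbers are used through addition, truncated
subtraction, halving and comparison only, and there is no conversion from real numbers to natural
numbers. -/

namespace RealRAM

/-- A machine state. -/
structure State where
  /-- natural-number registers -/
  nreg : ℕ → ℕ
  /-- natural-number memory -/
  nmem : ℕ → ℕ
  /-- real registers -/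
  rreg : ℕ → ℝ
  /-- real memory -/
  rmem : ℕ → ℝ

/-- Natural-number expressions. -/
inductive NExp where
  | const (c : ℕ)
  | reg (x : ℕ)
  | load (e : NExp)
  | add (e f : NExp)
  | sub (e f : NExp)
  | half (e : NExp)

/-- Real expressions. Besides the field operations and the square root there are `cos (π / N)` and
`sin (π / N)` for a natural number `N`, that is, a primitive root of unity of order `2N`. -/
inductive RExp where
  | const (c : ℤ)
  | reg (x : ℕ)
  | load (e : NExp)
  | add (e f : RExp)
  | sub (e f : RExp)
  | mul (e f : RExp)
  | div (e f : RExp)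
  | sqrt (e : RExp)
  | cosPi (e : NExp)
  | sinPi (e : NExp)

/-- Tests. -/
inductive BExp where
  | nle (e f : NExp)
  | rle (e f : RExp)
  | not (b : BExp)

/-- Commands. `call i` runs the `i`-th procedure; all registers and memory are global, so a
recursive procedure has to keep its own stack in memory. -/
inductive Cmd where
  | skip
  | setN (x : ℕ) (e : NExp)
  | storeN (a e : NExp)
  | setR (x : ℕ) (e : RExp)
  | storeR (a : NExp) (e : RExp)
  | seq (c d : Cmd)
  | ite (b : BExp) (c d : Cmd)
  | while (b : BExp) (c : Cmd)
  | call (i : ℕ)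

/-- A program: a main command and finitely many procedure bodies. -/
structure Program where
  main : Cmd
  procs : List Cmd

/-- The value of a natural-number expression. -/
def NExp.eval (s : State) : NExp → ℕ
  | .const c => c
  | .reg x => s.nreg x
  | .load e => s.nmem (e.eval s)
  | .add e f => e.eval s + f.eval s
  | .sub e f => e.eval s - f.eval s
  | .half e => e.eval s / 2

/-- The cost of evaluating a natural-number expression: the number of its nodes. -/
def NExp.cost : NExp → ℕ
  | .const _ => 1
  | .reg _ => 1
  | .load e => e.cost + 1
  | .add e f => e.cost + f.cost + 1
  | .sub e f => e.cost + f.cost + 1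
  | .half e => e.cost + 1

/-- The value of a real expression. (A quotient by `0` and the square root of a negative number
are `0`; since programs can test for these cases, this changes no running time by more than a
constant factor.) -/
noncomputable def RExp.eval (s : State) : RExp → ℝ
  | .const c => (c : ℝ)
  | .reg x => s.rreg x
  | .load e => s.rmem (e.eval s)
  | .add e f => e.eval s + f.eval s
  | .sub e f => e.eval s - f.eval s
  | .mul e f => e.eval s * f.eval s
  | .div e f => e.eval s / f.eval s
  | .sqrt e => Real.sqrt (e.eval s)
  | .cosPi e => Real.cos (Real.pi / (e.eval s : ℝ))
  | .sinPi e => Real.sin (Real.pi / (e.eval s : ℝ))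

/-- The cost of evaluating a real expression: the number of its nodes. -/
def RExp.cost : RExp → ℕ
  | .const _ => 1
  | .reg _ => 1
  | .load e => e.cost + 1
  | .add e f => e.cost + f.cost + 1
  | .sub e f => e.cost + f.cost + 1
  | .mul e f => e.cost + f.cost + 1
  | .div e f => e.cost + f.cost + 1
  | .sqrt e => e.cost + 1
  | .cosPi e => e.cost + 1
  | .sinPi e => e.cost + 1

/-- The truth of a test. -/
def BExp.holds (s : State) : BExp → Prop
  | .nle e f => e.eval s ≤ f.eval s
  | .rle e f => e.eval s ≤ f.eval s
  | .not b => ¬ b.holds s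

/-- The cost of a test. -/
def BExp.cost : BExp → ℕ
  | .nle e f => e.cost + f.cost + 1
  | .rle e f => e.cost + f.cost + 1
  | .not b => b.cost + 1

/-- `Exec procs c s t s'`: with the procedures `procs`, the command `c` started in state `s`
halts in state `s'` after exactly `t` steps. -/
inductive Exec (procs : List Cmd) : Cmd → State → ℕ → State → Prop
  | skip (s : State) : Exec procs .skip s 1 s
  | setN (s : State) (x : ℕ) (e : NExp) :
      Exec procs (.setN x e) s (e.cost + 1)
        { s with nreg := Function.update s.nreg x (e.eval s) }
  | storeN (s : State) (a e : NExp) :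
      Exec procs (.storeN a e) s (a.cost + e.cost + 1)
        { s with nmem := Function.update s.nmem (a.eval s) (e.eval s) }
  | setR (s : State) (x : ℕ) (e : RExp) :
      Exec procs (.setR x e) s (e.cost + 1)
        { s with rreg := Function.update s.rreg x (e.eval s) }
  | storeR (s : State) (a : NExp) (e : RExp) :
      Exec procs (.storeR a e) s (a.cost + e.cost + 1)
        { s with rmem := Function.update s.rmem (a.eval s) (e.eval s) }
  | seq {c d : Cmd} {s s' s'' : State} {t t' : ℕ}
      (hc : Exec procs c s t s') (hd : Exec procs d s' t' s'') :
      Exec procs (.seq c d) s (t + t') s''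
  | ite_true {b : BExp} {c d : Cmd} {s s' : State} {t : ℕ}
      (hb : b.holds s) (hc : Exec procs c s t s') :
      Exec procs (.ite b c d) s (b.cost + t + 1) s'
  | ite_false {b : BExp} {c d : Cmd} {s s' : State} {t : ℕ}
      (hb : ¬ b.holds s) (hd : Exec procs d s t s') :
      Exec procs (.ite b c d) s (b.cost + t + 1) s'
  | while_true {b : BExp} {c : Cmd} {s s' s'' : State} {t t' : ℕ}
      (hb : b.holds s) (hc : Exec procs c s t s') (hw : Exec procs (.while b c) s' t' s'') :
      Exec procs (.while b c) s (b.cost + t + t' + 1) s''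
  | while_false {b : BExp} {c : Cmd} {s : State} (hb : ¬ b.holds s) :
      Exec procs (.while b c) s (b.cost + 1) s
  | call {i : ℕ} {c : Cmd} {s s' : State} {t : ℕ}
      (hi : procs[i]? = some c) (hc : Exec procs c s t s') :
      Exec procs (.call i) s (t + 1) s'

/-- `P.HaltsIn s t s'`: the program `P` started in `s` halts in `s'` after exactly `t` steps. -/
def Program.HaltsIn (P : Program) (s : State) (t : ℕ) (s' : State) : Prop :=
  Exec P.procs P.main s t s'

/-- The initial state: `n` is in natural-number register `0`, the entries of `b` are in cells
`0, …, m - 1` of the real memory, and everything else is `0`. -/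
def inputState {m : ℕ} (n : ℕ) (b : Fin m → ℝ) : State where
  nreg := fun x => if x = 0 then n else 0
  nmem := fun _ => 0
  rreg := fun _ => 0
  rmem := fun a => if h : a < m then b ⟨a, h⟩ else 0

end RealRAM

/-! ## Complex arithmetic and loops on the real RAM -/

/-! Put `ζ = exp (πi/n)`. The circulant eigenvalues are geometric sums: `λ_0 = n`, `λ_k = 0` for
even `k ≠ 0`, and `λ_k = 2 / (1 - ζ ^ (-k))` for odd `k`. As `F` is unitary, `x = C_F† b` is the
solution of the normal equations `G* (G x - F b) = 0` with `G = √Σ F E`, which is unique because `G`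
is injective (`pinv_mulVec_eq`, `encoder_injective`). Only `n + 1` rows of `G` are nonzero: those of
odd frequency, on which the DFT of `n` points is an invertible, negacyclic transform, and the row of
frequency `0`.

The odd rows alone are solved exactly by `x₀ = negacyclicSol`, a negacyclic convolution of `b a - b
(n + a)` with the inverse odd transform of `1 / √λ`. The row of frequency `0` costs a rank-one
correction `x = x₀ + c u`. The direction `u` is chosen with odd transform `λ / |λ|`, so that the odd
frequencies contribute `c` times the inverse transform of `λ` to the normal equations. The odd
transform of the all-ones vector is `λ`, so this contribution is the constant `n c` in every
coordinate. The contribution of frequency `0` is constant too, and `c` is chosen to make the two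
cancel (`leastSquares_normal`). In closed form `u m = 1 / (n sin (π (2m + 1) / 2n))`, so `u` needs
no transform. The decoder then takes prefix sums of `x₀` and of `u`.

Two convolutions remain. The kernel of `x₀` is a transform of arbitrary length `n`; the identity
`(2j + 1) d = d² + d + j² - (d - j)²` turns it into a linear convolution with a chirp (`kernel_eq`).
Extending the kernel with a sign makes the negacyclic convolution linear as well. Each is read off
from a product of polynomials of degrees below `n` and `2n`, taken modulo `X ^ (2 ^ k) - i` with `2
^ k ≥ 3n`, where nothing wraps around (`polyMul_eq_sum`). Such a product is computed by splitting `X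
^ (2m) - w²` into `(X ^ m - w) (X ^ m + w)` recursively (`polyMul_dvd`), at cost `O(k 2 ^ k)`. The
total is `O(n log n)`, within the bound claimed. -/

namespace RealRAM

/-- The complex number held by real registers `2x + 2` and `2x + 3`; the real registers `0` and `1`
are scratch. -/
def State.creg (s : State) (x : ℕ) : ℂ := ⟨s.rreg (2 * x + 2), s.rreg (2 * x + 3)⟩

/-- The complex number held by real memory cells `2i` and `2i + 1`. -/
def State.cmem (s : State) (i : ℕ) : ℂ := ⟨s.rmem (2 * i), s.rmem (2 * i + 1)⟩

def State.setN (s : State) (x v : ℕ) : State :=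
  { s with nreg := Function.update s.nreg x v }

/-- Write `v` to complex register `x` and to the scratch registers. -/
def State.setC (s : State) (x : ℕ) (v : ℂ) : State :=
  { s with rreg := Function.update (Function.update (Function.update (Function.update s.rreg
      0 v.re) 1 v.im) (2 * x + 2) v.re) (2 * x + 3) v.im }

/-- Write `v` to complex memory cell `a` and to the scratch registers. -/
def State.storeC (s : State) (a : ℕ) (v : ℂ) : State :=
  { s with
    rreg := Function.update (Function.update s.rreg 0 v.re) 1 v.im
    rmem := Function.update (Function.update s.rmem (2 * a) v.re) (2 * a + 1) v.im }

def State.storeR (s : State) (a : ℕ) (v : ℝ) : State :=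
  { s with rmem := Function.update s.rmem a v }

section StateLemmas

variable (s : State) (x y a i v : ℕ) (z : ℂ) (r : ℝ)

@[simp] theorem State.nreg_setN : (s.setN x v).nreg = Function.update s.nreg x v := rfl
@[simp] theorem State.rmem_setN : (s.setN x v).rmem = s.rmem := rfl
@[simp] theorem State.creg_setN : (s.setN x v).creg y = s.creg y := rfl
@[simp] theorem State.cmem_setN : (s.setN x v).cmem i = s.cmem i := rfl
@[simp] theorem State.nreg_setC : (s.setC x z).nreg = s.nreg := rfl
@[simp] theorem State.rmem_setC : (s.setC x z).rmem = s.rmem := rfl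
@[simp] theorem State.cmem_setC : (s.setC x z).cmem i = s.cmem i := rfl
@[simp] theorem State.nreg_storeC : (s.storeC a z).nreg = s.nreg := rfl
@[simp] theorem State.nreg_storeR : (s.storeR a r).nreg = s.nreg := rfl
@[simp] theorem State.creg_storeR : (s.storeR a r).creg y = s.creg y := rfl
@[simp] theorem State.rmem_storeR : (s.storeR a r).rmem = Function.update s.rmem a r := rfl

@[simp] theorem State.creg_setC : (s.setC x z).creg y = if y = x then z else s.creg y := by
  rcases eq_or_ne y x with rfl | h
  · simp [State.creg, State.setC]
  · simp [State.creg, State.setC, h,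
      show ¬ 2 * y = 2 * x + 1 by omega, show ¬ 2 * y + 3 = 2 * x + 2 by omega]

@[simp] theorem State.creg_storeC : (s.storeC a z).creg y = s.creg y := by
  simp [State.creg, State.storeC]

@[simp] theorem State.cmem_storeC :
    (s.storeC a z).cmem i = if i = a then z else s.cmem i := by
  rcases eq_or_ne i a with rfl | h
  · simp [State.cmem, State.storeC]
  · simp [State.cmem, State.storeC, h,
      show ¬ 2 * i = 2 * a + 1 by omega, show ¬ 2 * i + 1 = 2 * a by omega]

theorem State.rmem_eq_of_cmem_eq {s s' : State} {j : ℕ} (h : s.cmem (j / 2) = s'.cmem (j / 2)) :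
    s.rmem j = s'.rmem j := by
  simp only [State.cmem, Complex.mk.injEq] at h
  rcases Nat.mod_two_eq_zero_or_one j with hj | hj
  · rw [show j = 2 * (j / 2) by omega]; exact h.1
  · rw [show j = 2 * (j / 2) + 1 by omega]; exact h.2

theorem State.cmem_storeR_of_ne (h : i ≠ a / 2) : (s.storeR a r).cmem i = s.cmem i := by
  simp only [State.cmem, State.rmem_storeR]
  rw [Function.update_of_ne (by omega), Function.update_of_ne (by omega)]

end StateLemmas

/-! ### Complex expressions compiled to pairs of real ones -/

/-- The square root in the right half plane of a complex number off the negative real axis. -/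
noncomputable def csqrt (z : ℂ) : ℂ :=
  let r := √((√(z.re * z.re + z.im * z.im) + z.re) / 2)
  ⟨r, z.im / (r + r)⟩

/-- Complex-valued expressions; `load` reads a complex memory cell, `cell` a real one, and
`root N` is `exp (π i / N)`. -/
inductive CExp where
  | const (a b : ℤ)
  | reg (x : ℕ)
  | load (e : NExp)
  | cell (e : NExp)
  | root (e : NExp)
  | conj (e : CExp)
  | im (e : CExp)
  | add (e f : CExp)
  | sub (e f : CExp)
  | mul (e f : CExp)
  | div (e f : CExp)
  | csqrt (e : CExp)

/-- Real expressions for the real and imaginary parts. -/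
def CExp.parts : CExp → RExp × RExp
  | .const a b => (.const a, .const b)
  | .reg x => (.reg (2 * x + 2), .reg (2 * x + 3))
  | .load e => (.load (.add e e), .load (.add (.add e e) (.const 1)))
  | .cell e => (.load e, .const 0)
  | .root e => (.cosPi e, .sinPi e)
  | .conj e => (e.parts.1, .sub (.const 0) e.parts.2)
  | .im e => (e.parts.2, .const 0)
  | .add e f => (.add e.parts.1 f.parts.1, .add e.parts.2 f.parts.2)
  | .sub e f => (.sub e.parts.1 f.parts.1, .sub e.parts.2 f.parts.2)
  | .mul e f => (.sub (.mul e.parts.1 f.parts.1) (.mul e.parts.2 f.parts.2),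
      .add (.mul e.parts.1 f.parts.2) (.mul e.parts.2 f.parts.1))
  | .div e f =>
      let d := RExp.add (.mul f.parts.1 f.parts.1) (.mul f.parts.2 f.parts.2)
      (.add (.div (.mul e.parts.1 f.parts.1) d) (.div (.mul e.parts.2 f.parts.2) d),
        .sub (.div (.mul e.parts.2 f.parts.1) d) (.div (.mul e.parts.1 f.parts.2) d))
  | .csqrt e =>
      let r := RExp.sqrt (.div (.add (.sqrt (.add (.mul e.parts.1 e.parts.1)
        (.mul e.parts.2 e.parts.2))) e.parts.1) (.const 2))
      (r, .div e.parts.2 (.add r r))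

/-- The value of a complex expression. -/
noncomputable def CExp.eval (s : State) : CExp → ℂ
  | .const a b => ⟨a, b⟩
  | .reg x => s.creg x
  | .load e => s.cmem (e.eval s)
  | .cell e => (s.rmem (e.eval s) : ℂ)
  | .root e => Complex.exp (Real.pi / (e.eval s : ℂ) * Complex.I)
  | .conj e => (starRingEnd ℂ) (e.eval s)
  | .im e => ((e.eval s).im : ℂ)
  | .add e f => e.eval s + f.eval s
  | .sub e f => e.eval s - f.eval s
  | .mul e f => e.eval s * f.eval s
  | .div e f => e.eval s / f.eval s
  | .csqrt e => RealRAM.csqrt (e.eval s)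

theorem CExp.eval_parts (s : State) (e : CExp) :
    e.parts.1.eval s = (e.eval s).re ∧ e.parts.2.eval s = (e.eval s).im := by
  induction e with
  | const a b => simp [parts, eval, RExp.eval]
  | reg x => simp [parts, eval, RExp.eval, State.creg]
  | load e => simp [parts, eval, RExp.eval, State.cmem, NExp.eval, two_mul]
  | cell e => simp [parts, eval, RExp.eval]
  | root e =>
    have h : (Real.pi / (e.eval s : ℂ) * Complex.I)
        = ((Real.pi / (e.eval s : ℝ) : ℝ) : ℂ) * Complex.I := by push_cast; rfl
    simp only [parts, eval, RExp.eval, h, Complex.exp_ofReal_mul_I_re,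
      Complex.exp_ofReal_mul_I_im, and_self]
  | conj e ih => simp [parts, eval, RExp.eval, ih]
  | im e ih => simp [parts, eval, RExp.eval, ih]
  | add e f ihe ihf => simp [parts, eval, RExp.eval, ihe, ihf]
  | sub e f ihe ihf => simp [parts, eval, RExp.eval, ihe, ihf]
  | mul e f ihe ihf => simp [parts, eval, RExp.eval, ihe, ihf]
  | div e f ihe ihf =>
    simp [parts, eval, RExp.eval, ihe, ihf, Complex.div_re, Complex.div_im, Complex.normSq_apply]
  | csqrt e ih => simp [parts, eval, RExp.eval, ih, RealRAM.csqrt]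

theorem NExp.eval_congr {s s' : State} (hn : s.nreg = s'.nreg) (hm : s.nmem = s'.nmem)
    (e : NExp) : e.eval s = e.eval s' := by
  induction e <;> simp_all [NExp.eval]

theorem CExp.eval_congr {s s' : State} (hn : s.nreg = s'.nreg) (hm : s.nmem = s'.nmem)
    (hr : s.rmem = s'.rmem) (hc : ∀ x, s.creg x = s'.creg x) (e : CExp) :
    e.eval s = e.eval s' := by
  induction e <;> simp_all [CExp.eval, NExp.eval_congr hn hm, State.cmem]

/-- Straight-line instructions. -/
inductive Op where
  | setN (x : ℕ) (e : NExp)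
  | setC (x : ℕ) (e : CExp)
  | storeC (a : NExp) (e : CExp)
  | storeR (a : NExp) (e : CExp)

/-- Both parts are computed into scratch before the target is touched, so the target may occur in
the expression; writing the real part first would corrupt the imaginary one. -/
def Op.toCmd : Op → Cmd
  | .setN x e => .setN x e
  | .setC x e => .seq (.setR 0 e.parts.1) (.seq (.setR 1 e.parts.2)
      (.seq (.setR (2 * x + 2) (.reg 0)) (.setR (2 * x + 3) (.reg 1))))
  | .storeC a e => .seq (.setR 0 e.parts.1) (.seq (.setR 1 e.parts.2)
      (.seq (.storeR (.add a a) (.reg 0)) (.storeR (.add (.add a a) (.const 1)) (.reg 1))))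
  | .storeR a e => .storeR a e.parts.1

def Op.cost : Op → ℕ
  | .setN _ e => e.cost + 1
  | .setC _ e => e.parts.1.cost + e.parts.2.cost + 6
  | .storeC a e => e.parts.1.cost + e.parts.2.cost + 4 * a.cost + 10
  | .storeR a e => a.cost + e.parts.1.cost + 1

noncomputable def Op.run (s : State) : Op → State
  | .setN x e => s.setN x (e.eval s)
  | .setC x e => s.setC x (e.eval s)
  | .storeC a e => s.storeC (a.eval s) (e.eval s)
  | .storeR a e => s.storeR (a.eval s) (e.eval s).re

/-! ### Time-bounded execution and loops -/

/-- The program `c` started in `s` halts in `s'` within `B` steps. -/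
def Runs (procs : List Cmd) (c : Cmd) (s : State) (B : ℕ) (s' : State) : Prop :=
  ∃ t ≤ B, Exec procs c s t s'

variable {procs : List Cmd}

theorem Runs.mono {c : Cmd} {s s' : State} {B B' : ℕ} (h : Runs procs c s B s') (hB : B ≤ B') :
    Runs procs c s B' s' := by
  obtain ⟨t, ht, h⟩ := h
  exact ⟨t, ht.trans hB, h⟩

theorem Runs.seq {c d : Cmd} {s s' s'' : State} {B B' : ℕ} (hc : Runs procs c s B s')
    (hd : Runs procs d s' B' s'') : Runs procs (.seq c d) s (B + B') s'' := by
  obtain ⟨t, ht, hc⟩ := hc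
  obtain ⟨t', ht', hd⟩ := hd
  exact ⟨t + t', by omega, .seq hc hd⟩

theorem Runs.ite_true {b : BExp} {c d : Cmd} {s s' : State} {B : ℕ} (hb : b.holds s)
    (hc : Runs procs c s B s') : Runs procs (.ite b c d) s (B + b.cost + 1) s' := by
  obtain ⟨t, ht, hc⟩ := hc
  exact ⟨b.cost + t + 1, by omega, .ite_true hb hc⟩

theorem Runs.ite_false {b : BExp} {c d : Cmd} {s s' : State} {B : ℕ} (hb : ¬ b.holds s)
    (hd : Runs procs d s B s') : Runs procs (.ite b c d) s (B + b.cost + 1) s' := by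
  obtain ⟨t, ht, hd⟩ := hd
  exact ⟨b.cost + t + 1, by omega, .ite_false hb hd⟩

theorem Runs.call {i : ℕ} {c : Cmd} {s s' : State} {B : ℕ} (hi : procs[i]? = some c)
    (hc : Runs procs c s B s') : Runs procs (.call i) s (B + 1) s' := by
  obtain ⟨t, ht, hc⟩ := hc
  exact ⟨t + 1, by omega, .call hi hc⟩

theorem Exec.of_eq {c : Cmd} {s s' s'' : State} {t : ℕ} (h : Exec procs c s t s')
    (hs : s' = s'') : Exec procs c s t s'' :=
  hs ▸ h

theorem Op.runs (s : State) (o : Op) : Runs procs o.toCmd s o.cost (o.run s) := by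
  cases o with
  | setN x e => exact ⟨_, le_rfl, .setN s x e⟩
  | storeR a e =>
    refine ⟨_, le_rfl, ?_⟩
    have h := Exec.storeR (procs := procs) s a e.parts.1
    rw [(e.eval_parts s).1] at h
    exact h
  | setC x e =>
    have h1 := Exec.setR (procs := procs) s 0 e.parts.1
    have h2 := Exec.setR (procs := procs)
      { s with rreg := Function.update s.rreg 0 (e.parts.1.eval s) } 1 e.parts.2
    -- Complex registers begin at real register `2`, so a write to scratch cannot change the value
    -- of `e`.
    have he : e.eval { s with rreg := Function.update s.rreg 0 (e.parts.1.eval s) } = e.eval s :=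
      by
      refine CExp.eval_congr ?_ ?_ ?_ (fun y => ?_) e <;> simp [State.creg]
    rw [(CExp.eval_parts _ _).2, he, (CExp.eval_parts _ _).1] at h2
    rw [(CExp.eval_parts _ _).1] at h1
    have h := Exec.seq h1 (Exec.seq h2 (Exec.seq (Exec.setR _ (2 * x + 2) (.reg 0))
      (Exec.setR _ (2 * x + 3) (.reg 1))))
    refine ⟨_, ?_, h⟩
    simp only [RExp.cost, Op.cost]
    omega
  | storeC a e =>
    have h1 := Exec.setR (procs := procs) s 0 e.parts.1
    have h2 := Exec.setR (procs := procs)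
      { s with rreg := Function.update s.rreg 0 (e.parts.1.eval s) } 1 e.parts.2
    have he : e.eval { s with rreg := Function.update s.rreg 0 (e.parts.1.eval s) } = e.eval s :=
      by
      refine CExp.eval_congr ?_ ?_ ?_ (fun y => ?_) e <;> simp [State.creg]
    rw [(CExp.eval_parts _ _).2, he, (CExp.eval_parts _ _).1] at h2
    rw [(CExp.eval_parts _ _).1] at h1
    have h := Exec.seq h1 (Exec.seq h2 (Exec.seq (Exec.storeR _ (.add a a) (.reg 0))
      (Exec.storeR _ (.add (.add a a) (.const 1)) (.reg 1))))
    have ha (rr rm : ℕ → ℝ) : a.eval ⟨s.nreg, s.nmem, rr, rm⟩ = a.eval s := by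
      refine NExp.eval_congr ?_ ?_ a <;> rfl
    refine ⟨_, ?_, h.of_eq ?_⟩
    · simp only [RExp.cost, Op.cost, NExp.cost]
      omega
    · simp [NExp.eval, RExp.eval, ha, Op.run, State.storeC, ← two_mul]

/-- Straight-line programs. -/
def block : List Op → Cmd
  | [] => .skip
  | o :: l => .seq o.toCmd (block l)

def blockCost : List Op → ℕ
  | [] => 1
  | o :: l => o.cost + blockCost l

noncomputable def blockRun : List Op → State → State
  | [], s => s
  | o :: l, s => blockRun l (o.run s)

theorem block_runs (l : List Op) (s : State) :
    Runs procs (block l) s (blockCost l) (blockRun l s) := by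
  induction l generalizing s with
  | nil => exact ⟨1, le_rfl, .skip s⟩
  | cons o l ih => exact (o.runs s).seq (ih _)

theorem Runs.while_true {b : BExp} {c : Cmd} {s s' s'' : State} {B B' : ℕ} (hb : b.holds s)
    (hc : Runs procs c s B s') (hw : Runs procs (.while b c) s' B' s'') :
    Runs procs (.while b c) s (b.cost + B + 1 + B') s'' := by
  obtain ⟨t, ht, hc⟩ := hc
  obtain ⟨t', ht', hw⟩ := hw
  exact ⟨b.cost + t + t' + 1, by omega, .while_true hb hc hw⟩

/-- A loop whose body, while the counter is `k < N`, takes a state satisfying `I k` to one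
satisfying `I (k + 1)`. -/
theorem Runs.while_invariant {b : BExp} {c : Cmd} {B N : ℕ} (I : ℕ → State → Prop) {s : State}
    (h0 : I 0 s) (hstep : ∀ k < N, ∀ s, I k s → b.holds s ∧ ∃ s', Runs procs c s B s' ∧ I (k + 1) s')
    (hend : ∀ s, I N s → ¬ b.holds s) :
    ∃ s', Runs procs (.while b c) s (N * (b.cost + B + 1) + (b.cost + 1)) s' ∧ I N s' := by
  suffices H : ∀ m k s, m + k = N → I k s →
      ∃ s', Runs procs (.while b c) s (m * (b.cost + B + 1) + (b.cost + 1)) s' ∧ I N s' from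
    H N 0 s rfl h0
  intro m
  induction m with
  | zero =>
    intro k s hk hI
    obtain rfl : k = N := by omega
    exact ⟨s, ⟨b.cost + 1, by omega, .while_false (hend s hI)⟩, hI⟩
  | succ m ih =>
    intro k s hk hI
    obtain ⟨hb, s1, hr, hI1⟩ := hstep k (by omega) s hI
    obtain ⟨s2, hr2, hI2⟩ := ih (k + 1) s1 (by omega) hI1
    exact ⟨s2, (hr.while_true hb hr2).mono (by ring_nf; omega), hI2⟩

/-- `for` loop with counter in register `3`, running while the counter is less than register
`lim`. -/
def forLoop (lim : ℕ) (l : List Op) : Cmd :=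
  .while (.nle (.add (.reg 3) (.const 1)) (.reg lim))
    (.seq (block l) (block [.setN 3 (.add (.reg 3) (.const 1))]))

/-- The `20` generously covers the test, the increment and the final failing test. -/
def forCost (l : List Op) : ℕ := blockCost l + 20

theorem forLoop_runs {lim : ℕ} (hlim : lim ≠ 3) {l : List Op} {N : ℕ} (I : ℕ → State → Prop)
    {s : State} (hctr : s.nreg 3 = 0) (hN : s.nreg lim = N) (h0 : I 0 s)
    (hstep : ∀ k < N, ∀ s', s'.nreg = Function.update s.nreg 3 k → I k s' →
      (blockRun l s').nreg = s'.nreg ∧ I (k + 1) ((blockRun l s').setN 3 (k + 1))) :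
    ∃ s', Runs procs (forLoop lim l) s ((N + 1) * forCost l) s' ∧
      s'.nreg = Function.update s.nreg 3 N ∧ I N s' := by
  obtain ⟨s', hr, hn, hI⟩ := Runs.while_invariant (procs := procs)
    (b := .nle (.add (.reg 3) (.const 1)) (.reg lim))
    (c := .seq (block l) (block [.setN 3 (.add (.reg 3) (.const 1))]))
    (B := blockCost l + blockCost [.setN 3 (.add (.reg 3) (.const 1))]) (N := N)
    (I := fun k s' => s'.nreg = Function.update s.nreg 3 k ∧ I k s') (s := s)
    ⟨by rw [← hctr, Function.update_eq_self], h0⟩ (by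
      rintro k hk s' ⟨hn, hI⟩
      obtain ⟨hn', hI'⟩ := hstep k hk s' hn hI
      refine ⟨?_, _, (block_runs l s').seq (block_runs _ _), ?_, ?_⟩
      · simp [BExp.holds, NExp.eval, hn, hlim, hN]; omega
      · simp [blockRun, Op.run, NExp.eval, hn', hn]
      · simpa [blockRun, Op.run, NExp.eval, hn', hn] using hI') (by
      rintro s' ⟨hn, hI⟩
      simp [BExp.holds, NExp.eval, hn, hlim, hN])
  refine ⟨s', hr.mono ?_, hn, hI⟩
  simp only [blockCost, Op.cost, NExp.cost, BExp.cost, forCost]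
  ring_nf
  omega

/-! ## Polynomial multiplication by recursive splitting -/

/-- Off the negative axis `|z| + Re z` is positive, so the division in `csqrt` is genuine; squaring
then uses `|z|² = (Re z)² + (Im z)²`. -/
theorem csqrt_aux {z : ℂ} (hz : z ∈ Complex.slitPlane) :
    0 < (csqrt z).re ∧ csqrt z * csqrt z = z := by
  set m := √(z.re * z.re + z.im * z.im) with hm
  have hm0 : 0 ≤ m := Real.sqrt_nonneg _
  have hmm : m * m = z.re * z.re + z.im * z.im := Real.mul_self_sqrt (add_nonneg (mul_self_nonneg _) (mul_self_nonneg _))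
  have hpos : 0 < m + z.re := by
    rcases hz with h | h
    · linarith
    · have : 0 < z.im * z.im := mul_self_pos.2 h
      nlinarith
  have hr : 0 < √((m + z.re) / 2) := Real.sqrt_pos.2 (by linarith)
  have hrr : √((m + z.re) / 2) * √((m + z.re) / 2) = (m + z.re) / 2 :=
    Real.mul_self_sqrt (by linarith)
  have hdef : csqrt z = ⟨√((m + z.re) / 2), z.im / (√((m + z.re) / 2) + √((m + z.re) / 2))⟩ := rfl
  set r := √((m + z.re) / 2)
  refine ⟨by rw [hdef]; exact hr, ?_⟩
  rw [hdef]
  apply Complex.ext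
  · simp only [Complex.mul_re]
    field_simp
    nlinarith
  · simp only [Complex.mul_im]
    field_simp

theorem csqrt_re_pos {z : ℂ} (hz : z ∈ Complex.slitPlane) : 0 < (csqrt z).re := (csqrt_aux hz).1

theorem csqrt_mul_self {z : ℂ} (hz : z ∈ Complex.slitPlane) : csqrt z * csqrt z = z :=
  (csqrt_aux hz).2

/-- Keeps the recursion alive: a non-real modulus constant has non-real square roots `± w`, so no
level meets the branch cut or divides by `w = 0`. -/
theorem csqrt_im_ne_zero {z : ℂ} (hz : z.im ≠ 0) : (csqrt z).im ≠ 0 := by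
  intro h
  have h2 := congrArg Complex.im (csqrt_mul_self (z := z) (.inr hz))
  rw [Complex.mul_im, h] at h2
  simp at h2
  exact hz h2.symm

/-- Butterflies between the first `k` cells of `[O, O + H)` and of `[O + H, O + 2H)`: reduction
modulo `X ^ m - w` and `X ^ m + w`. -/
def butterfly (O H k : ℕ) (w : ℂ) (M : ℕ → ℂ) (x : ℕ) : ℂ :=
  if O ≤ x ∧ x < O + k then M x + w * M (x + H)
  else if O + H ≤ x ∧ x < O + H + k then M (x - H) - w * M x
  else M x

/-- The inverse butterflies. -/
noncomputable def unbutterfly (O H k : ℕ) (w : ℂ) (M : ℕ → ℂ) (x : ℕ) : ℂ :=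
  if O ≤ x ∧ x < O + k then (M x + M (x + H)) / 2
  else if O + H ≤ x ∧ x < O + H + k then (M (x - H) - M x) / (w + w)
  else M x

/-- The effect on memory of multiplying, modulo `X ^ (2 ^ k) - c`, the polynomials whose coefficients
are in the even and in the odd cells of the block of length `2 ^ (k + 1)` at `O`. -/
noncomputable def polyMul : ℕ → ℂ → ℕ → (ℕ → ℂ) → ℕ → ℂ
  | 0, _, O, M => Function.update M O (M O * M (O + 1))
  | k + 1, c, O, M =>
      let w := csqrt c
      let H := 2 ^ (k + 1)
      unbutterfly O H H w (polyMul k (-w) (O + H) (polyMul k w O (butterfly O H H w M)))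

theorem polyMul_of_notMem (k : ℕ) (c : ℂ) (O : ℕ) (M : ℕ → ℂ) (x : ℕ)
    (hx : x < O ∨ O + 2 ^ (k + 1) ≤ x) : polyMul k c O M x = M x := by
  induction k generalizing c O M with
  | zero =>
    rw [polyMul, Function.update_of_ne]
    rintro rfl
    simp at hx
  | succ k ih =>
    have h2 : 2 ^ (k + 1 + 1) = 2 ^ (k + 1) + 2 ^ (k + 1) := by ring
    rw [polyMul, unbutterfly, if_neg (by omega), if_neg (by omega), ih _ _ _ (by omega),
      ih _ _ _ (by omega), butterfly, if_neg (by omega), if_neg (by omega)]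

open Polynomial in
/-- The polynomial with `m` coefficients in the cells `O, O + 2, O + 4, …`. -/
noncomputable def cellPoly (m O : ℕ) (M : ℕ → ℂ) : ℂ[X] :=
  ∑ j ∈ Finset.range m, C (M (O + 2 * j)) * X ^ j

open Polynomial in
theorem cellPoly_add (m O : ℕ) (M : ℕ → ℂ) :
    cellPoly (m + m) O M = cellPoly m O M + X ^ m * cellPoly m (O + 2 * m) M := by
  rw [cellPoly, Finset.sum_range_add, cellPoly, cellPoly, Finset.mul_sum]
  congr 1
  refine Finset.sum_congr rfl fun j _ => ?_
  rw [show O + 2 * (m + j) = O + 2 * m + 2 * j by ring]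
  ring

theorem cellPoly_congr {m O : ℕ} {M M' : ℕ → ℂ} (h : ∀ j < m, M (O + 2 * j) = M' (O + 2 * j)) :
    cellPoly m O M = cellPoly m O M' :=
  Finset.sum_congr rfl fun j hj => by rw [h j (Finset.mem_range.1 hj)]

open Polynomial in
theorem cellPoly_linear {m O P Q : ℕ} {M M' M'' : ℕ → ℂ} {a b : ℂ}
    (h : ∀ j < m, M (O + 2 * j) = a * M' (P + 2 * j) + b * M'' (Q + 2 * j)) :
    cellPoly m O M = C a * cellPoly m P M' + C b * cellPoly m Q M'' := by
  simp only [cellPoly, Finset.mul_sum, ← Finset.sum_add_distrib]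
  refine Finset.sum_congr rfl fun j hj => ?_
  rw [h j (Finset.mem_range.1 hj)]
  simp only [C_add, C_mul]
  ring

/-- Chinese remaindering for one factor: with `h = 1/2` and `a = 1/(2w)`, the interpolant `(P + Q)/2
+ x (P - Q)/(2w)` becomes `P` at `x = w`. Here `x` stands for `X ^ m`. -/
theorem sub_dvd_of_halves {R : Type*} [CommRing R] {x w a h A₀ A₁ B₀ B₁ P Q : R}
    (hh : h + h = 1) (hi : w * a = h) (d : x - w ∣ (A₀ + w * A₁) * (B₀ + w * B₁) - P) :
    x - w ∣ (A₀ + x * A₁) * (B₀ + x * B₁) - (h * P + h * Q + x * (a * P + -a * Q)) := by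
  obtain ⟨q, hq⟩ := d
  refine ⟨q + (A₀ * B₁ + A₁ * B₀ + (x + w) * A₁ * B₁ - a * (P - Q)), ?_⟩
  linear_combination hq - (P - Q) * hi - P * hh

-- With `A = A₀ + X ^ m A₁`, the butterflies form `A₀ ± w A₁`, the residues modulo `X ^ m ∓ w`, for
-- both factors at once since their coefficients are interleaved. The recursive calls multiply the
-- residues, and the inverse butterflies glue the two results.
open Polynomial in
theorem polyMul_dvd (k : ℕ) (c : ℂ) (hc : c.im ≠ 0) (O : ℕ) (M : ℕ → ℂ) :
    X ^ 2 ^ k - C c ∣ cellPoly (2 ^ k) O M * cellPoly (2 ^ k) (O + 1) M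
      - cellPoly (2 ^ k) O (polyMul k c O M) := by
  induction k generalizing c O M with
  | zero => simp [cellPoly, polyMul]
  | succ k ih =>
    set w := csqrt c with hw
    have hww : w * w = c := csqrt_mul_self (.inr hc)
    have hwi : w.im ≠ 0 := csqrt_im_ne_zero hc
    have hw0 : w ≠ 0 := by rintro h; simp [h] at hwi
    set m := 2 ^ k with hm
    have hH : 2 ^ (k + 1) = 2 * m := by rw [pow_succ, mul_comm]
    set M1 := butterfly O (2 * m) (2 * m) w M with hM1
    set M2 := polyMul k w O M1 with hM2
    set M3 := polyMul k (-w) (O + 2 * m) M2 with hM3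
    have hR : polyMul (k + 1) c O M = unbutterfly O (2 * m) (2 * m) w M3 := by
      simp only [polyMul, hH, hM3, hM2, hM1, hw]
    have b1 (e : ℕ) (he : e ≤ 1) : cellPoly m (O + e) M1
        = C 1 * cellPoly m (O + e) M + C w * cellPoly m (O + e + 2 * m) M :=
      cellPoly_linear fun j hj => by
        simp only [hM1, butterfly]
        rw [if_pos (by omega), one_mul, show O + e + 2 * j + 2 * m = O + e + 2 * m + 2 * j by ring]
    have b2 (e : ℕ) (he : e ≤ 1) : cellPoly m (O + 2 * m + e) M1
        = C 1 * cellPoly m (O + e) M + C (-w) * cellPoly m (O + e + 2 * m) M :=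
      cellPoly_linear fun j hj => by
        simp only [hM1, butterfly]
        rw [if_neg (by omega), if_pos (by omega), one_mul,
          show O + e + 2 * m + 2 * j = O + 2 * m + e + 2 * j by ring,
          show O + 2 * m + e + 2 * j - 2 * m = O + e + 2 * j by omega]
        ring
    have u1 : cellPoly m O (unbutterfly O (2 * m) (2 * m) w M3)
        = C (1 / 2) * cellPoly m O M3 + C (1 / 2) * cellPoly m (O + 2 * m) M3 :=
      cellPoly_linear fun j hj => by
        simp only [unbutterfly]
        rw [if_pos (by omega), show O + 2 * j + 2 * m = O + 2 * m + 2 * j by ring]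
        ring
    have u2 : cellPoly m (O + 2 * m) (unbutterfly O (2 * m) (2 * m) w M3)
        = C (1 / (w + w)) * cellPoly m O M3 + C (-1 / (w + w)) * cellPoly m (O + 2 * m) M3 :=
      cellPoly_linear fun j hj => by
        simp only [unbutterfly]
        rw [if_neg (by omega), if_pos (by omega),
          show O + 2 * m + 2 * j - 2 * m = O + 2 * j by omega]
        ring
    have d1 := ih w hwi O M1
    have d2 := ih (-w) (by simpa using hwi) (O + 2 * m) M2
    have e1 : cellPoly m O M2 = cellPoly m O M3 := cellPoly_congr fun j hj =>
      (polyMul_of_notMem _ _ _ _ _ (by omega)).symm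
    have e2 (e : ℕ) (he : e ≤ 1) : cellPoly m (O + 2 * m + e) M2 = cellPoly m (O + 2 * m + e) M1 :=
      cellPoly_congr fun j hj => polyMul_of_notMem _ _ _ _ _ (by omega)
    rw [← hM2, e1] at d1
    rw [← hM3] at d2
    have e20 := e2 0 (by omega)
    have b10 := b1 0 (by omega)
    have b20 := b2 0 (by omega)
    simp only [add_zero] at e20 b10 b20
    rw [b10, b1 1 le_rfl] at d1
    rw [e20, e2 1 le_rfl, b20, b2 1 le_rfl] at d2
    rw [hR, show 2 ^ (k + 1) = m + m by omega, cellPoly_add, cellPoly_add, cellPoly_add, u1, u2]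
    have hfac : (X : ℂ[X]) ^ (m + m) - C c = (X ^ m - C w) * (X ^ m - C (-w)) := by
      rw [← hww]; simp only [C_mul, C_neg]; ring
    -- The two factors differ by the nonzero constant `2w`.
    have hcop : IsCoprime ((X : ℂ[X]) ^ m - C w) (X ^ m - C (-w)) := by
      refine ⟨-C (1 / (w + w)), C (1 / (w + w)), ?_⟩
      have : C (1 / (w + w)) * (C w + C w) = (1 : ℂ[X]) := by
        rw [← C_add, ← C_mul, one_div_mul_cancel (by simpa using hw0), C_1]
      simp only [C_neg]
      linear_combination this
    have hh : C (1 / 2 : ℂ) + C (1 / 2) = 1 := by rw [← C_add]; norm_num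
    have hi : C w * C (1 / (w + w)) = C (1 / 2 : ℂ) := by
      rw [← C_mul]; congr 1; field_simp; norm_num
    have hneg : C (-1 / (w + w)) = -C (1 / (w + w)) := by rw [← C_neg, neg_div]
    rw [hfac, hneg]
    simp only [C_1, one_mul] at d1 d2
    refine hcop.mul_dvd (sub_dvd_of_halves hh hi d1) ?_
    -- The other factor is the same statement with `w`, `a` negated and the two residues exchanged.
    have := sub_dvd_of_halves (a := -C (1 / (w + w))) (Q := cellPoly m O M3) hh
      (by rw [C_neg, neg_mul_neg, hi]) d2
    convert this using 2
    ring


open Polynomial in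
theorem coeff_cellPoly (m O : ℕ) (M : ℕ → ℂ) (i : ℕ) :
    (cellPoly m O M).coeff i = if i < m then M (O + 2 * i) else 0 := by
  simp [cellPoly, finsetSum_coeff, coeff_C_mul, coeff_X_pow]

theorem natDegree_cellPoly_lt {m : ℕ} (hm : 0 < m) (O : ℕ) (M : ℕ → ℂ) :
    (cellPoly m O M).natDegree < m := by
  refine Nat.lt_of_le_pred hm (Polynomial.natDegree_le_iff_coeff_eq_zero.2 fun i hi => ?_)
  rw [coeff_cellPoly, if_neg]
  exact not_lt.2 (Nat.le_of_pred_lt hi)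

theorem cellPoly_eq_of_le {m m' O : ℕ} {M : ℕ → ℂ} (h : m ≤ m')
    (h0 : ∀ j, m ≤ j → j < m' → M (O + 2 * j) = 0) : cellPoly m' O M = cellPoly m O M := by
  ext i
  rw [coeff_cellPoly, coeff_cellPoly]
  split_ifs with h1 h2 h2
  · rfl
  · exact h0 i (by omega) h1
  · omega
  · rfl

/-- When the product does not wrap around, `polyMul` computes a convolution. -/
theorem polyMul_eq_sum {k n : ℕ} (hk : 3 * n ≤ 2 ^ k) {c : ℂ} (hc : c.im ≠ 0) {O : ℕ} {M : ℕ → ℂ}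
    (hA : ∀ j, n ≤ j → j < 2 ^ k → M (O + 2 * j) = 0)
    (hB : ∀ j, 2 * n ≤ j → j < 2 ^ k → M (O + 2 * j + 1) = 0) {i : ℕ} (hi : i < n) :
    polyMul k c O M (O + 2 * (n + i))
      = ∑ j ∈ Finset.range n, M (O + 2 * j) * M (O + 2 * (n + i - j) + 1) := by
  have hpos : 0 < 2 ^ k := by positivity
  have hdvd := polyMul_dvd k c hc O M
  have hA' := cellPoly_eq_of_le (O := O) (M := M) (m := n) (m' := 2 ^ k) (by omega) hA
  have hB' := cellPoly_eq_of_le (O := O + 1) (M := M) (m := 2 * n) (m' := 2 ^ k) (by omega)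
    fun j h1 h2 => by rw [add_right_comm]; exact hB j h1 h2
  have hdA := natDegree_cellPoly_lt (m := n) (by omega) O M
  have hdB := natDegree_cellPoly_lt (m := 2 * n) (by omega) (O + 1) M
  have hdR := natDegree_cellPoly_lt hpos O (polyMul k c O M)
  -- The product has degree at most `(n - 1) + (2n - 1) < 2 ^ k`, so the congruence is an equality.
  have hzero := Polynomial.eq_zero_of_dvd_of_natDegree_lt hdvd (by
    rw [Polynomial.natDegree_X_pow_sub_C, hA', hB']
    refine (Polynomial.natDegree_sub_le _ _).trans_lt (max_lt ?_ hdR)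
    refine Polynomial.natDegree_mul_le.trans_lt ?_
    omega)
  have hco := congrArg (fun p => Polynomial.coeff p (n + i)) (sub_eq_zero.1 hzero)
  rw [coeff_cellPoly, if_pos (by omega)] at hco
  rw [← hco, Polynomial.coeff_mul, Finset.Nat.sum_antidiagonal_eq_sum_range_succ
    (fun a b => (cellPoly (2 ^ k) O M).coeff a * (cellPoly (2 ^ k) (O + 1) M).coeff b)]
  rw [← Finset.sum_subset (s₁ := Finset.range n)]
  · refine Finset.sum_congr rfl fun j hj => ?_
    have := Finset.mem_range.1 hj
    rw [coeff_cellPoly, coeff_cellPoly, if_pos (by omega), if_pos (by omega), add_right_comm]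
  · exact Finset.range_subset_range.2 (by omega)
  · intro j hj hj'
    rw [hA', coeff_cellPoly, if_neg (by simpa using hj'), zero_mul]

/-! ### The program for polynomial multiplication -/

def butterflyOps : List Op :=
  [.setC 2 (.load (.add (.reg 1) (.reg 3))),
   .setC 3 (.mul (.reg 1) (.load (.add (.add (.reg 1) (.reg 2)) (.reg 3)))),
   .storeC (.add (.reg 1) (.reg 3)) (.add (.reg 2) (.reg 3)),
   .storeC (.add (.add (.reg 1) (.reg 2)) (.reg 3)) (.sub (.reg 2) (.reg 3))]

def unbutterflyOps : List Op :=
  [.setC 2 (.load (.add (.reg 1) (.reg 3))),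
   .setC 3 (.load (.add (.add (.reg 1) (.reg 2)) (.reg 3))),
   .storeC (.add (.reg 1) (.reg 3)) (.div (.add (.reg 2) (.reg 3)) (.const 2 0)),
   .storeC (.add (.add (.reg 1) (.reg 2)) (.reg 3))
    (.div (.sub (.reg 2) (.reg 3)) (.add (.reg 1) (.reg 1)))]

def baseOps : List Op :=
  [.storeC (.reg 1) (.mul (.load (.reg 1)) (.load (.add (.reg 1) (.const 1))))]

def splitOps : List Op :=
  [.setN 2 (.half (.reg 2)), .setC 1 (.csqrt (.reg 1)), .setN 3 (.const 0)]

def secondHalfOps : List Op :=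
  [.setN 1 (.add (.reg 1) (.reg 2)), .setC 1 (.sub (.const 0 0) (.reg 1))]

def joinOps : List Op :=
  [.setN 1 (.sub (.reg 1) (.reg 2)), .setC 1 (.sub (.const 0 0) (.reg 1)), .setN 3 (.const 0)]

/-- Squaring `w` gives back `c`; this is how the recursion does without saving it. -/
def restoreOps : List Op :=
  [.setN 2 (.add (.reg 2) (.reg 2)), .setC 1 (.mul (.reg 1) (.reg 1))]

/-- The recursive procedure for `polyMul`: start of the block in register `1`, its length in register
`2`, and `c` in complex register `1`. All three are restored, so no stack is needed. -/
def polyMulProc : Cmd :=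
  .ite (.nle (.reg 2) (.const 2)) (block baseOps)
    (.seq (block splitOps) <| .seq (forLoop 2 butterflyOps) <| .seq (.call 0) <|
      .seq (block secondHalfOps) <| .seq (.call 0) <| .seq (block joinOps) <|
      .seq (forLoop 2 unbutterflyOps) (block restoreOps))

def polyMulOverhead : ℕ :=
  blockCost baseOps + blockCost splitOps + blockCost secondHalfOps + blockCost joinOps
    + blockCost restoreOps + 10

def polyMulCost : ℕ → ℕ
  | 0 => polyMulOverhead
  | k + 1 => 2 * polyMulCost k
      + ((2 ^ (k + 1) + 1) * (forCost butterflyOps + forCost unbutterflyOps) + polyMulOverhead)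

/-- Each of the `k` levels costs `O(2 ^ k)` in total. -/
theorem polyMulCost_le : ∃ C, ∀ k, polyMulCost k ≤ C * ((k + 1) * 2 ^ k) := by
  refine ⟨2 * (forCost butterflyOps + forCost unbutterflyOps) + polyMulOverhead, fun k => ?_⟩
  induction k with
  | zero => simp [polyMulCost]
  | succ k ih =>
    have h1 : 1 ≤ 2 ^ k := Nat.one_le_two_pow
    rw [polyMulCost, pow_succ]
    generalize forCost butterflyOps + forCost unbutterflyOps = D at *
    generalize polyMulOverhead = E at *
    generalize 2 ^ k = m at *
    calc 2 * polyMulCost k + ((m * 2 + 1) * D + E)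
        ≤ 2 * ((2 * D + E) * ((k + 1) * m)) + ((m * 2 + m * 2) * D + m * 2 * E) := by gcongr <;> nlinarith
      _ = _ := by ring

theorem butterfly_runs {s : State} {O H : ℕ} {w : ℂ} (hO : s.nreg 1 = O) (hH : s.nreg 2 = H)
    (h3 : s.nreg 3 = 0) (hw : s.creg 1 = w) :
    ∃ s', Runs procs (forLoop 2 butterflyOps) s ((H + 1) * forCost butterflyOps) s' ∧
      s'.nreg = Function.update s.nreg 3 H ∧ (∀ x, x = 1 ∨ 4 ≤ x → s'.creg x = s.creg x) ∧
      ∀ x, s'.cmem x = butterfly O H H w s.cmem x := by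
  refine forLoop_runs (by norm_num) (fun k s' => (∀ x, x = 1 ∨ 4 ≤ x → s'.creg x = s.creg x) ∧
    ∀ x, s'.cmem x = butterfly O H k w s.cmem x) h3 hH ⟨fun _ _ => rfl, fun x => ?_⟩ ?_
  · rw [butterfly, if_neg (by omega), if_neg (by omega)]
  · rintro k hk s' hn ⟨hc, hm⟩
    have hw' : s'.creg 1 = w := by rw [hc 1 (.inl rfl), hw]
    refine ⟨by simp [blockRun, butterflyOps, Op.run], ?_, ?_⟩
    · intro x hx
      have h2 : x ≠ 2 := by omega
      have h3 : x ≠ 3 := by omega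
      simp [blockRun, butterflyOps, Op.run, h2, h3, hc x hx]
    · intro x
      simp [blockRun, butterflyOps, Op.run, NExp.eval, CExp.eval, hn, hO, hH, hw', hm]
      -- The pair handled in round `k` has not been touched by earlier rounds.
      have e1 : butterfly O H k w s.cmem (O + k) = s.cmem (O + k) := by
        rw [butterfly, if_neg (by omega), if_neg (by omega)]
      have e2 : butterfly O H k w s.cmem (O + H + k) = s.cmem (O + H + k) := by
        rw [butterfly, if_neg (by omega), if_neg (by omega)]
      rw [e1, e2]
      split_ifs with h1 h2
      · subst h1
        rw [butterfly, if_neg (by omega), if_pos (by omega), show O + H + k - H = O + k by omega]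
      · subst h2
        rw [butterfly, if_pos (by omega), add_right_comm]
      · unfold butterfly
        split_ifs <;> first | rfl | omega

theorem unbutterfly_runs {s : State} {O H : ℕ} {w : ℂ} (hO : s.nreg 1 = O) (hH : s.nreg 2 = H)
    (h3 : s.nreg 3 = 0) (hw : s.creg 1 = w) :
    ∃ s', Runs procs (forLoop 2 unbutterflyOps) s ((H + 1) * forCost unbutterflyOps) s' ∧
      s'.nreg = Function.update s.nreg 3 H ∧ (∀ x, x = 1 ∨ 4 ≤ x → s'.creg x = s.creg x) ∧
      ∀ x, s'.cmem x = unbutterfly O H H w s.cmem x := by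
  refine forLoop_runs (by norm_num) (fun k s' => (∀ x, x = 1 ∨ 4 ≤ x → s'.creg x = s.creg x) ∧
    ∀ x, s'.cmem x = unbutterfly O H k w s.cmem x) h3 hH ⟨fun _ _ => rfl, fun x => ?_⟩ ?_
  · rw [unbutterfly, if_neg (by omega), if_neg (by omega)]
  · rintro k hk s' hn ⟨hc, hm⟩
    have hw' : s'.creg 1 = w := by rw [hc 1 (.inl rfl), hw]
    have h2' : (⟨2, 0⟩ : ℂ) = 2 := rfl
    refine ⟨by simp [blockRun, unbutterflyOps, Op.run], ?_, ?_⟩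
    · intro x hx
      have h2 : x ≠ 2 := by omega
      have h3 : x ≠ 3 := by omega
      simp [blockRun, unbutterflyOps, Op.run, h2, h3, hc x hx]
    · intro x
      simp [blockRun, unbutterflyOps, Op.run, NExp.eval, CExp.eval, hn, hO, hH, hw', hm, h2']
      have e1 : unbutterfly O H k w s.cmem (O + k) = s.cmem (O + k) := by
        rw [unbutterfly, if_neg (by omega), if_neg (by omega)]
      have e2 : unbutterfly O H k w s.cmem (O + H + k) = s.cmem (O + H + k) := by
        rw [unbutterfly, if_neg (by omega), if_neg (by omega)]
      rw [e1, e2]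
      split_ifs with h1 h2
      · subst h1
        rw [unbutterfly, if_neg (by omega), if_pos (by omega), show O + H + k - H = O + k by omega]
      · subst h2
        rw [unbutterfly, if_pos (by omega), add_right_comm]
      · unfold unbutterfly
        split_ifs <;> first | rfl | omega

/-- The preservation clauses are part of the induction: the second call and the restoration rely on
what the first call leaves. Only the counter and complex registers `2`, `3` (besides scratch) may be
lost. -/
theorem polyMul_runs (k : ℕ) {s : State} (hL : s.nreg 2 = 2 ^ (k + 1)) (hc : (s.creg 1).im ≠ 0) :
    ∃ s', Runs [polyMulProc] polyMulProc s (polyMulCost k) s' ∧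
      (∀ x, x ≠ 3 → s'.nreg x = s.nreg x) ∧ (∀ x, x = 1 ∨ 4 ≤ x → s'.creg x = s.creg x) ∧
      ∀ x, s'.cmem x = polyMul k (s.creg 1) (s.nreg 1) s.cmem x := by
  induction k generalizing s with
  | zero =>
    refine ⟨_, (Runs.ite_true ?_ (block_runs baseOps s)).mono ?_, ?_⟩
    · simp [BExp.holds, NExp.eval, hL]
    · simp only [BExp.cost, NExp.cost, polyMulCost, polyMulOverhead]; omega
    · simp [blockRun, baseOps, Op.run, NExp.eval, CExp.eval, polyMul, Function.update_apply]
  | succ k ih =>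
    set w := csqrt (s.creg 1) with hw
    have hww : w * w = s.creg 1 := csqrt_mul_self (.inr hc)
    have hwi : w.im ≠ 0 := csqrt_im_ne_zero hc
    set H := 2 ^ (k + 1) with hH
    have hL' : s.nreg 2 = H + H := by rw [hL, pow_succ, hH]; ring
    set O := s.nreg 1 with hO
    have r1 := block_runs (procs := [polyMulProc]) splitOps s
    set s1 := blockRun splitOps s with hs1
    have n1 : s1.nreg = Function.update (Function.update s.nreg 2 H) 3 0 := by
      simp [hs1, blockRun, splitOps, Op.run, NExp.eval, hL', ← two_mul]
    have c1 (x : ℕ) : s1.creg x = if x = 1 then w else s.creg x := by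
      simp [hs1, blockRun, splitOps, Op.run, CExp.eval, hw]
    have m1 (x : ℕ) : s1.cmem x = s.cmem x := by
      simp [hs1, blockRun, splitOps, Op.run]
    clear_value s1
    obtain ⟨s2, r2, n2, c2, m2⟩ := butterfly_runs (procs := [polyMulProc]) (s := s1) (O := O) (H := H)
      (w := w) (by simp [n1, hO]) (by simp [n1]) (by simp [n1]) (by simp [c1])
    obtain ⟨s3, r3, n3, c3, m3⟩ := ih (s := s2) (by simp [n2, n1])
      (by rw [c2 1 (.inl rfl), c1]; simpa using hwi)
    have r4 := block_runs (procs := [polyMulProc]) secondHalfOps s3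
    set s4 := blockRun secondHalfOps s3 with hs4
    have n4 (x : ℕ) (hx : x ≠ 3) : s4.nreg x = if x = 1 then O + H else if x = 2 then H else s.nreg x := by
      simp [hs4, blockRun, secondHalfOps, Op.run, NExp.eval, Function.update_apply, n3, n2, n1, hx, hO]
    have c4 (x : ℕ) (hx : x = 1 ∨ 4 ≤ x) : s4.creg x = if x = 1 then -w else s.creg x := by
      rcases hx with rfl | hx
      · simp [hs4, blockRun, secondHalfOps, Op.run, CExp.eval, c3, c2, c1, Complex.ext_iff]
      · have h1 : x ≠ 1 := by omega
        simp [hs4, blockRun, secondHalfOps, Op.run, h1, c3 x (.inr hx), c2 x (.inr hx), c1]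
    have m4 (x : ℕ) : s4.cmem x = s3.cmem x := by
      simp [hs4, blockRun, secondHalfOps, Op.run]
    clear_value s4
    obtain ⟨s5, r5, n5, c5, m5⟩ := ih (s := s4) (by simp [n4])
      (by simpa [c4] using hwi)
    have r6 := block_runs (procs := [polyMulProc]) joinOps s5
    set s6 := blockRun joinOps s5 with hs6
    have n6 (x : ℕ) : s6.nreg x = if x = 1 then O else if x = 2 then H else if x = 3 then 0 else s.nreg x := by
      by_cases hx : x = 3
      · simp [hs6, blockRun, joinOps, Op.run, NExp.eval, hx]
      · simp [hs6, blockRun, joinOps, Op.run, NExp.eval, Function.update_apply, n5, n4, hx]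
        split_ifs <;> rfl
    have c6 (x : ℕ) (hx : x = 1 ∨ 4 ≤ x) : s6.creg x = if x = 1 then w else s.creg x := by
      rcases hx with rfl | hx
      · simp [hs6, blockRun, joinOps, Op.run, CExp.eval, c5, c4, Complex.ext_iff]
      · have h1 : x ≠ 1 := by omega
        simp [hs6, blockRun, joinOps, Op.run, h1, c5 x (.inr hx), c4 x (.inr hx)]
    have m6 (x : ℕ) : s6.cmem x = s5.cmem x := by
      simp [hs6, blockRun, joinOps, Op.run]
    clear_value s6
    obtain ⟨s7, r7, n7, c7, m7⟩ := unbutterfly_runs (procs := [polyMulProc]) (s := s6) (O := O) (H := H)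
      (w := w) (by simp [n6]) (by simp [n6]) (by simp [n6]) (by simp [c6])
    have r8 := block_runs (procs := [polyMulProc]) restoreOps s7
    refine ⟨_, (Runs.ite_false ?_ (r1.seq (r2.seq ((r3.call rfl).seq (r4.seq ((r5.call rfl).seq
      (r6.seq (r7.seq r8)))))))).mono ?_, ?_, ?_, ?_⟩
    · have : 1 ≤ 2 ^ k := Nat.one_le_two_pow
      simp [BExp.holds, NExp.eval, hL, pow_succ]
      omega
    · simp only [BExp.cost, NExp.cost, polyMulCost, polyMulOverhead]
      rw [← hH, mul_add]
      omega
    · intro x hx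
      rcases eq_or_ne x 2 with rfl | h2
      · simp [blockRun, restoreOps, Op.run, NExp.eval, n7, n6, hL']
      · rcases eq_or_ne x 1 with rfl | h1
        · simp [blockRun, restoreOps, Op.run, n7, n6, hO]
        · simp [blockRun, restoreOps, Op.run, n7, n6, hx, h1, h2]
    · rintro x (rfl | hx)
      · simp [blockRun, restoreOps, Op.run, CExp.eval, c7, c6, hww]
      · have h1 : x ≠ 1 := by omega
        simp [blockRun, restoreOps, Op.run, h1, c7 x (.inr hx), c6 x (.inr hx)]
    · intro x
      have f2 : s2.cmem = butterfly O H H w s.cmem := by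
        funext y; rw [m2]; congr 1; funext y; exact m1 y
      have f3 : s3.cmem = polyMul k w O s2.cmem := by
        funext y; rw [m3]; simp [c2, c1, n2, n1, hO]
      have f5 : s5.cmem = polyMul k (-w) (O + H) s3.cmem := by
        funext y; rw [m5, show s4.cmem = s3.cmem from funext m4]; simp [c4, n4]
      simp [blockRun, restoreOps, Op.run, m7, polyMul, show s6.cmem = s5.cmem from funext m6, f5, f3,
        f2, ← hw, ← hH]


@[simp] theorem State.rmem_storeC_eq (s : State) (a : ℕ) (z : ℂ) :
    (s.storeC a z).rmem
      = Function.update (Function.update s.rmem (2 * a) z.re) (2 * a + 1) z.im := rfl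

/-! ### The quantities computed by the program -/

/-- `exp (π i / N)`. -/
noncomputable def zeta (N : ℕ) : ℂ := Complex.exp (Real.pi / (N : ℂ) * Complex.I)

/-- The reciprocal square root of the eigenvalue at frequency `2j + 1`. -/
noncomputable def invSqrtEig (n j : ℕ) : ℂ :=
  csqrt ((1 - (starRingEnd ℂ) (zeta n ^ (2 * j + 1))) / 2)

/-- The chirp filter `ζ ^ (-d ^ 2)`, stored at offset `n`: `e = n + d` or `e = n - d`. -/
noncomputable def chirp (n e : ℕ) : ℂ :=
  if n ≤ e then (starRingEnd ℂ) (zeta n ^ ((e - n) * (e - n)))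
  else (starRingEnd ℂ) (zeta n ^ ((n - e) * (n - e)))

/-- The entries of the negacyclic inverse of `√Σ`, by the chirp transform. -/
noncomputable def kernel (n m : ℕ) : ℂ :=
  zeta n ^ (m * m + m) * (∑ j ∈ Finset.range n,
    invSqrtEig n j * zeta n ^ (j * j) * chirp n (n + m - j)) / n

/-- The negacyclic extension of `kernel`, with offset `n`. -/
noncomputable def kernelExt (n e : ℕ) : ℂ := if n ≤ e then kernel n (e - n) else -kernel n e

/-- The preimage of `b` under the negacyclic factor of the encoder. -/
noncomputable def negacyclicSol (n : ℕ) (b : ℕ → ℝ) (m : ℕ) : ℂ :=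
  ∑ a ∈ Finset.range n, ((b a : ℂ) - b (n + a)) * kernelExt n (n + m - a)

/-- The direction of the rank-one correction. -/
noncomputable def correction (n m : ℕ) : ℂ := 1 / (n * ((zeta (n + n) ^ (2 * m + 1)).im : ℂ))

/-- The coefficient of the rank-one correction. -/
noncomputable def correctionCoeff (n : ℕ) (b : ℕ → ℝ) : ℂ :=
  ((∑ j ∈ Finset.range n, ((b j : ℂ) + b (n + j))) / csqrt n
    - ∑ j ∈ Finset.range n, negacyclicSol n b j) / (1 + ∑ j ∈ Finset.range n, correction n j)

/-! ### The program -/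

/-- Natural registers: `0` holds `n`, `1` the start of the current work block, `2` its length, `3`
the loop counter, and later `4` the start of the previous block. The first block starts at complex
cell `2n`, clear of the input. -/
def initOps : List Op :=
  [.setN 1 (.add (.reg 0) (.reg 0)), .setN 2 (.const 2)]

/-- A block of length `2 ^ (k + 1)` interleaves two polynomials of length `2 ^ k`, so comparing with
`6n` enforces `3n ≤ 2 ^ k`. -/
def sizeTest : BExp :=
  .not (.nle (.add (.add (.add (.reg 0) (.reg 0)) (.add (.reg 0) (.reg 0)))
    (.add (.reg 0) (.reg 0))) (.reg 2))

def doubleOps : List Op := [.setN 2 (.add (.reg 2) (.reg 2))]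

def chirpInitOps : List Op :=
  [.setN 3 (.const 0), .setC 4 (.const 1 0), .setC 5 (.root (.reg 0)),
    .setC 11 (.mul (.reg 5) (.reg 5)), .setC 6 (.const 0 0)]

/-- Complex registers `4`, `5`, `11` hold `ζ ^ (k²)`, `ζ ^ (2k + 1)`, `ζ²`, so each power costs one
multiplication. Register `6` counts in the reals, because natural numbers cannot be converted; it
ends as `n`. -/
def chirpOps : List Op :=
  [.setC 2 (.csqrt (.div (.sub (.const 1 0) (.conj (.reg 5))) (.const 2 0))),
    .storeC (.add (.reg 1) (.add (.reg 3) (.reg 3))) (.mul (.reg 2) (.reg 4)),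
    .storeC (.add (.add (.reg 1) (.add (.add (.reg 0) (.reg 3)) (.add (.reg 0) (.reg 3))))
      (.const 1)) (.conj (.reg 4)),
    .storeC (.add (.add (.reg 1) (.add (.sub (.reg 0) (.reg 3)) (.sub (.reg 0) (.reg 3))))
      (.const 1)) (.conj (.reg 4)),
    .setC 4 (.mul (.reg 4) (.reg 5)), .setC 5 (.mul (.reg 5) (.reg 11)),
    .setC 6 (.add (.reg 6) (.const 1 0))]

/-- Any non-real constant would do for the modulus. -/
def modulusOps : List Op := [.setC 1 (.const 0 1)]

def kernelInitOps : List Op :=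
  [.setN 4 (.reg 1), .setN 1 (.add (.reg 1) (.reg 2)), .setN 3 (.const 0),
    .setC 4 (.const 1 0), .setC 5 (.reg 11)]

def kernelOps : List Op :=
  [.setC 2 (.div (.mul (.reg 4) (.load (.add (.reg 4)
      (.add (.add (.reg 0) (.reg 3)) (.add (.reg 0) (.reg 3)))))) (.reg 6)),
    .storeC (.add (.reg 1) (.add (.reg 3) (.reg 3)))
      (.sub (.cell (.reg 3)) (.cell (.add (.reg 0) (.reg 3)))),
    .storeC (.add (.add (.reg 1) (.add (.reg 3) (.reg 3))) (.const 1))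
      (.sub (.const 0 0) (.reg 2)),
    .storeC (.add (.add (.reg 1) (.add (.add (.reg 0) (.reg 3)) (.add (.reg 0) (.reg 3))))
      (.const 1)) (.reg 2),
    .setC 4 (.mul (.reg 4) (.reg 5)), .setC 5 (.mul (.reg 5) (.reg 11))]

def prefixInitOps : List Op :=
  [.setN 3 (.const 0), .setC 4 (.root (.add (.reg 0) (.reg 0))),
    .setC 11 (.mul (.reg 4) (.reg 4)), .setC 7 (.const 0 0), .setC 8 (.const 0 0),
    .setC 9 (.const 0 0)]

/-- Registers `7`, `8`, `9` accumulate `x₀`, `u` and the entries of `b`. Prefix sums of `x₀`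
overwrite the input from the left, and those of `u` replace kernel entries no longer needed. -/
def prefixOps : List Op :=
  [.setC 7 (.add (.reg 7) (.load (.add (.reg 1)
      (.add (.add (.reg 0) (.reg 3)) (.add (.reg 0) (.reg 3)))))),
    .setC 8 (.add (.reg 8) (.div (.const 1 0) (.mul (.reg 6) (.im (.reg 4))))),
    .setC 9 (.add (.reg 9) (.add (.cell (.reg 3)) (.cell (.add (.reg 0) (.reg 3))))),
    .storeR (.reg 3) (.reg 7),
    .storeC (.add (.add (.reg 1) (.add (.reg 3) (.reg 3))) (.const 1)) (.reg 8),
    .setC 4 (.mul (.reg 4) (.reg 11))]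

def coeffOps : List Op :=
  [.setN 3 (.const 0),
    .setC 10 (.div (.sub (.div (.reg 9) (.csqrt (.reg 6))) (.reg 7))
      (.add (.const 1 0) (.reg 8)))]

def correctOps : List Op :=
  [.storeR (.reg 3) (.add (.cell (.reg 3)) (.mul (.reg 10) (.load
    (.add (.add (.reg 1) (.add (.reg 3) (.reg 3))) (.const 1)))))]

def decoderMain : Cmd :=
  .seq (block initOps) <| .seq (.while sizeTest (block doubleOps)) <|
  .seq (block chirpInitOps) <| .seq (forLoop 0 chirpOps) <|
  .seq (block modulusOps) <| .seq (.call 0) <|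
  .seq (block kernelInitOps) <| .seq (forLoop 0 kernelOps) <|
  .seq (block modulusOps) <| .seq (.call 0) <|
  .seq (block prefixInitOps) <| .seq (forLoop 0 prefixOps) <|
  .seq (block coeffOps) (forLoop 0 correctOps)

/-! ### Correctness of the loops of the main program -/

theorem size_runs {n : ℕ} {s : State} (h0 : s.nreg 0 = n) (h2 : s.nreg 2 = 2) :
    Runs procs (.while sizeTest (block doubleOps)) s
      (Nat.clog 2 (3 * n) * (sizeTest.cost + blockCost doubleOps + 1) + (sizeTest.cost + 1))
      (s.setN 2 (2 ^ (Nat.clog 2 (3 * n) + 1))) := by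
  obtain ⟨s', hr, rfl⟩ := Runs.while_invariant (procs := procs) (b := sizeTest)
    (c := block doubleOps) (B := blockCost doubleOps) (N := Nat.clog 2 (3 * n))
    (fun j s' => s' = s.setN 2 (2 ^ (j + 1))) (s := s)
    (by
      have h : Function.update s.nreg 2 2 = s.nreg := Function.update_eq_self_iff.2 h2.symm
      simp only [State.setN, zero_add, pow_one, h]) (by
      rintro k hk s' rfl
      have := Nat.pow_lt_of_lt_clog hk
      refine ⟨?_, _, block_runs _ _, ?_⟩
      · simp [sizeTest, BExp.holds, NExp.eval, h0, pow_succ]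
        omega
      · simp [blockRun, doubleOps, Op.run, State.setN, NExp.eval, pow_succ, mul_two]) (by
      rintro s' rfl
      have := Nat.le_pow_clog (b := 2) (by norm_num) (3 * n)
      simp [sizeTest, BExp.holds, NExp.eval, h0, pow_succ]
      omega)
  exact hr

/-- Leaves the two factors of the chirp convolution interleaved and padded with zeros, as
`polyMul_eq_sum` requires. The chirp at offset `0` is never used, since `n + m - j > 0` for `j < n`.
-/
theorem chirp_runs {n : ℕ} {s : State} (h0 : s.nreg 0 = n) (h1 : s.nreg 1 = 2 * n)
    (hm : ∀ x, 2 * n ≤ x → s.cmem x = 0) (h3 : s.nreg 3 = 0) (h4 : s.creg 4 = 1)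
    (h5 : s.creg 5 = zeta n) (h11 : s.creg 11 = zeta n ^ 2) (h6 : s.creg 6 = 0) :
    ∃ s', Runs procs (forLoop 0 chirpOps) s ((n + 1) * forCost chirpOps) s' ∧
      s'.nreg = Function.update s.nreg 3 n ∧
      s'.creg 11 = zeta n ^ 2 ∧ s'.creg 6 = n ∧
      (∀ j < n, s'.cmem (2 * n + 2 * j) = invSqrtEig n j * zeta n ^ (j * j)) ∧
      (∀ e, 0 < e → e < 2 * n → s'.cmem (2 * n + 2 * e + 1) = chirp n e) ∧
      (∀ j, n ≤ j → s'.cmem (2 * n + 2 * j) = 0) ∧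
      (∀ j, 2 * n ≤ j → s'.cmem (2 * n + 2 * j + 1) = 0) ∧
      ∀ x < 2 * n, s'.cmem x = s.cmem x := by
  obtain ⟨s', hr, hn, h⟩ := forLoop_runs (procs := procs) (lim := 0) (by norm_num) (l := chirpOps) (N := n)
    (s := s)
    (fun k s' => s'.creg 4 = zeta n ^ (k * k) ∧ s'.creg 5 = zeta n ^ (2 * k + 1) ∧
      s'.creg 11 = zeta n ^ 2 ∧ s'.creg 6 = k ∧
      (∀ j < k, s'.cmem (2 * n + 2 * j) = invSqrtEig n j * zeta n ^ (j * j)) ∧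
      (∀ e, n < e + k → e < n + k → s'.cmem (2 * n + 2 * e + 1) = chirp n e) ∧
      (∀ j, k ≤ j → s'.cmem (2 * n + 2 * j) = 0) ∧
      (∀ j, 2 * n ≤ j → s'.cmem (2 * n + 2 * j + 1) = 0) ∧
      ∀ x < 2 * n, s'.cmem x = s.cmem x) h3 h0
    ⟨by simp [h4], by simp [h5], h11, by simp [h6], by omega, by omega,
      fun j _ => hm _ (by omega), fun j _ => hm _ (by omega), fun _ _ => rfl⟩ (by
      rintro k hk s' hn ⟨i4, i5, i11, i6, iA, iB, iA', iB', iM⟩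
      have c1 : (⟨1, 0⟩ : ℂ) = 1 := rfl
      have c2 : (⟨2, 0⟩ : ℂ) = 2 := rfl
      have hcm (x : ℕ) : ((blockRun chirpOps s').setN 3 (k + 1)).cmem x
          = if x = 2 * n + 2 * (n - k) + 1 then (starRingEnd ℂ) (zeta n ^ (k * k))
            else if x = 2 * n + 2 * (n + k) + 1 then (starRingEnd ℂ) (zeta n ^ (k * k))
            else if x = 2 * n + 2 * k then invSqrtEig n k * zeta n ^ (k * k) else s'.cmem x := by
        simp [blockRun, chirpOps, Op.run, NExp.eval, CExp.eval, hn, h0, h1, i4, i5, c1, c2,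
          ← two_mul, invSqrtEig]
      refine ⟨by simp [blockRun, chirpOps, Op.run], ?_, ?_, ?_, ?_, ?_, ?_, ?_, ?_, ?_⟩
      · simp [blockRun, chirpOps, Op.run, CExp.eval, i4, i5, ← pow_add]
        congr 1; ring
      · simp [blockRun, chirpOps, Op.run, CExp.eval, i5, i11, ← pow_add]
        congr 1
      · simp [blockRun, chirpOps, Op.run, i11]
      · simp [blockRun, chirpOps, Op.run, CExp.eval, i6, c1]
      · intro j hj
        rw [hcm, if_neg (by omega), if_neg (by omega)]
        split_ifs with h
        · rw [show j = k by omega]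
        · exact iA j (by omega)
      · intro e h1 h2
        rw [hcm]
        split_ifs with g1 g2 g3
        · unfold chirp
          split_ifs
          · obtain rfl : k = 0 := by omega
            rw [show e - n = 0 by omega]
          · rw [show n - e = k by omega]
        · unfold chirp
          rw [if_pos (by omega), show e - n = k by omega]
        · omega
        · exact iB e (by omega) (by omega)
      · intro j hj
        rw [hcm, if_neg (by omega), if_neg (by omega), if_neg (by omega)]
        exact iA' j (by omega)
      · intro j hj
        rw [hcm, if_neg ?_, if_neg (by omega), if_neg (by omega)]
        · exact iB' j (by omega)
        · omega
      · intro x hx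
        rw [hcm, if_neg (by omega), if_neg (by omega), if_neg (by omega)]
        exact iM x hx)
  obtain ⟨-, -, i11, i6, iA, iB, iA', iB', iM⟩ := h
  exact ⟨s', hr, hn, i11, i6, iA, fun e _ _ => iB e (by omega) (by omega), iA', iB', iM⟩

/-- Prepares the second convolution in a fresh block. By `6n ≤ O` the values read from the previous
product, and the input, lie below everything written. -/
theorem kernel_runs {n O : ℕ} {s : State} {b : ℕ → ℝ} (h0 : s.nreg 0 = n) (h1 : s.nreg 1 = O)
    (h4 : s.nreg 4 = 2 * n) (hO : 6 * n ≤ O)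
    (hm : ∀ x, O ≤ x → s.cmem x = 0) (h3 : s.nreg 3 = 0) (hc4 : s.creg 4 = 1)
    (h5 : s.creg 5 = zeta n ^ 2) (h11 : s.creg 11 = zeta n ^ 2) (h6 : s.creg 6 = n)
    (hk : ∀ i < n, s.cmem (2 * n + 2 * (n + i)) = ∑ j ∈ Finset.range n,
      invSqrtEig n j * zeta n ^ (j * j) * chirp n (n + i - j))
    (hb : ∀ i < 2 * n, s.rmem i = b i) :
    ∃ s', Runs procs (forLoop 0 kernelOps) s ((n + 1) * forCost kernelOps) s' ∧
      s'.nreg = Function.update s.nreg 3 n ∧ s'.creg 6 = n ∧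
      (∀ j < n, s'.cmem (O + 2 * j) = (b j : ℂ) - b (n + j)) ∧
      (∀ e < 2 * n, s'.cmem (O + 2 * e + 1) = kernelExt n e) ∧
      (∀ j, n ≤ j → s'.cmem (O + 2 * j) = 0) ∧
      (∀ j, 2 * n ≤ j → s'.cmem (O + 2 * j + 1) = 0) ∧
      ∀ x < 2 * n, s'.rmem x = b x := by
  obtain ⟨s', hr, hn, h⟩ := forLoop_runs (procs := procs) (lim := 0) (by norm_num) (l := kernelOps) (N := n)
    (s := s)
    (fun k s' => s'.creg 4 = zeta n ^ (k * k + k) ∧ s'.creg 5 = zeta n ^ (2 * k + 2) ∧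
      s'.creg 11 = zeta n ^ 2 ∧ s'.creg 6 = n ∧
      (∀ j < k, s'.cmem (O + 2 * j) = (b j : ℂ) - b (n + j)) ∧
      (∀ e, e < k → s'.cmem (O + 2 * e + 1) = -kernel n e) ∧
      (∀ e, e < k → s'.cmem (O + 2 * (n + e) + 1) = kernel n e) ∧
      (∀ j, k ≤ j → s'.cmem (O + 2 * j) = 0) ∧
      (∀ j, 2 * n ≤ j → s'.cmem (O + 2 * j + 1) = 0) ∧
      ∀ x < O, s'.cmem x = s.cmem x) h3 h0
    ⟨by simp [hc4], by simp [h5], h11, h6, by omega, by omega, by omega,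
      fun j _ => hm _ (by omega), fun j _ => hm _ (by omega), fun _ _ => rfl⟩ (by
      rintro k hk' s' hn ⟨i4, i5, i11, i6, iA, iB, iC, iA', iB', iM⟩
      have hr (i : ℕ) (hi : i < 2 * n) : s'.rmem i = b i := by
        rw [← hb i hi]
        exact State.rmem_eq_of_cmem_eq (iM _ (by omega))
      have c0 : (⟨0, 0⟩ : ℂ) = 0 := rfl
      have hcm (x : ℕ) : ((blockRun kernelOps s').setN 3 (k + 1)).cmem x
          = if x = O + 2 * (n + k) + 1 then kernel n k
            else if x = O + 2 * k + 1 then -kernel n k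
            else if x = O + 2 * k then (b k : ℂ) - b (n + k) else s'.cmem x := by
        simp [blockRun, kernelOps, Op.run, NExp.eval, CExp.eval, hn, h0, h1, h4, i4, i6,
          ← two_mul, kernel, iM _ (show 2 * n + 2 * (n + k) < O by omega), hk k hk', hr k (by omega),
          hr (n + k) (by omega), c0]
      refine ⟨by simp [blockRun, kernelOps, Op.run], ?_, ?_, ?_, ?_, ?_, ?_, ?_, ?_, ?_, ?_⟩
      · simp [blockRun, kernelOps, Op.run, CExp.eval, i4, i5, ← pow_add]
        congr 1; ring
      · simp [blockRun, kernelOps, Op.run, CExp.eval, i5, i11, ← pow_add]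
        congr 1
      · simp [blockRun, kernelOps, Op.run, i11]
      · simp [blockRun, kernelOps, Op.run, i6]
      · intro j hj
        rw [hcm, if_neg (by omega), if_neg (by omega)]
        split_ifs with h
        · rw [show j = k by omega]
        · exact iA j (by omega)
      · intro e h1
        rw [hcm, if_neg (by omega)]
        split_ifs with g1 g2
        · rw [show e = k by omega]
        · omega
        · exact iB e (by omega)
      · intro e h1
        rw [hcm]
        split_ifs with g1 g2 g3
        · rw [show e = k by omega]
        · omega
        · omega
        · exact iC e (by omega)
      · intro j hj
        rw [hcm, if_neg (by omega), if_neg (by omega), if_neg (by omega)]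
        exact iA' j (by omega)
      · intro j hj
        rw [hcm, if_neg (by omega), if_neg (by omega), if_neg (by omega)]
        exact iB' j (by omega)
      · intro x hx
        rw [hcm, if_neg (by omega), if_neg (by omega), if_neg (by omega)]
        exact iM x hx)
  obtain ⟨-, -, -, i6, iA, iB, iC, iA', iB', iM⟩ := h
  refine ⟨s', hr, hn, i6, iA, fun e he => ?_, iA', iB', fun x hx => ?_⟩
  · unfold kernelExt
    split_ifs with h
    · obtain ⟨e, rfl⟩ := Nat.exists_eq_add_of_le h
      rw [Nat.add_sub_cancel_left]
      exact iC e (by omega)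
    · exact iB e (by omega)
  · rw [← hb x hx]
    exact State.rmem_eq_of_cmem_eq (iM _ (by omega))


theorem prefix_runs {n O : ℕ} {s : State} {b : ℕ → ℝ} (h0 : s.nreg 0 = n) (h1 : s.nreg 1 = O)
    (hO : 6 * n ≤ O) (h3 : s.nreg 3 = 0) (h4 : s.creg 4 = zeta (n + n))
    (h11 : s.creg 11 = zeta (n + n) ^ 2) (h6 : s.creg 6 = n) (h7 : s.creg 7 = 0)
    (h8 : s.creg 8 = 0) (h9 : s.creg 9 = 0)
    (hx : ∀ i < n, s.cmem (O + 2 * (n + i)) = negacyclicSol n b i)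
    (hb : ∀ i < 2 * n, s.rmem i = b i) :
    ∃ s', Runs procs (forLoop 0 prefixOps) s ((n + 1) * forCost prefixOps) s' ∧
      s'.nreg = Function.update s.nreg 3 n ∧ s'.creg 6 = n ∧
      s'.creg 7 = ∑ j ∈ Finset.range n, negacyclicSol n b j ∧
      s'.creg 8 = ∑ j ∈ Finset.range n, correction n j ∧
      s'.creg 9 = ∑ j ∈ Finset.range n, ((b j : ℂ) + b (n + j)) ∧
      (∀ j < n, s'.cmem (O + 2 * j + 1) = ∑ i ∈ Finset.range (j + 1), correction n i) ∧
      ∀ j < n, s'.rmem j = (∑ i ∈ Finset.range (j + 1), negacyclicSol n b i).re := by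
  obtain ⟨s', hr, hn, h⟩ := forLoop_runs (procs := procs) (lim := 0) (by norm_num) (l := prefixOps)
    (N := n) (s := s)
    (fun k s' => s'.creg 4 = zeta (n + n) ^ (2 * k + 1) ∧ s'.creg 11 = zeta (n + n) ^ 2 ∧
      s'.creg 6 = n ∧
      s'.creg 7 = ∑ j ∈ Finset.range k, negacyclicSol n b j ∧
      s'.creg 8 = ∑ j ∈ Finset.range k, correction n j ∧
      s'.creg 9 = ∑ j ∈ Finset.range k, ((b j : ℂ) + b (n + j)) ∧
      (∀ j < k, s'.cmem (O + 2 * j + 1) = ∑ i ∈ Finset.range (j + 1), correction n i) ∧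
      (∀ j < n, s'.cmem (O + 2 * (n + j)) = negacyclicSol n b j) ∧
      (∀ j < k, s'.rmem j = (∑ i ∈ Finset.range (j + 1), negacyclicSol n b i).re) ∧
      ∀ j, k ≤ j → j < 2 * n → s'.rmem j = b j) h3 h0
    ⟨by simp [h4], h11, h6, by simp [h7], by simp [h8], by simp [h9], by omega, hx, by omega,
      fun j _ => hb j⟩ (by
      rintro k hk s' hn ⟨i4, i11, i6, i7, i8, i9, iU, iX, iR, iB⟩
      have c1 : (⟨1, 0⟩ : ℂ) = 1 := rfl
      have hX := iX k hk
      have hcm (x : ℕ) (hx : O ≤ x) : ((blockRun prefixOps s').setN 3 (k + 1)).cmem x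
          = if x = O + 2 * k + 1 then ∑ i ∈ Finset.range (k + 1), correction n i
            else s'.cmem x := by
        -- Real cell `k`, which receives the prefix sum, lies inside complex cell `k / 2`, far below
        -- the work block.
        have hne : x ≠ k / 2 := by omega
        simp [blockRun, prefixOps, Op.run, NExp.eval, CExp.eval, hn, h0, h1, i4, i6, i8,
          ← two_mul, Finset.sum_range_succ, correction, c1, State.cmem_storeR_of_ne _ _ _ _ hne]
      have hrm (j : ℕ) (hj : j < 2 * n) : ((blockRun prefixOps s').setN 3 (k + 1)).rmem j
          = if j = k then (∑ i ∈ Finset.range (k + 1), negacyclicSol n b i).re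
            else s'.rmem j := by
        have g1 : j ≠ 2 * (O + 2 * k + 1) := by omega
        have g2 : j ≠ 2 * (O + 2 * k + 1) + 1 := by omega
        simp [blockRun, prefixOps, Op.run, NExp.eval, CExp.eval, hn, h0, h1, i7, hX,
          ← two_mul, Finset.sum_range_succ, Function.update_apply, g1, g2]
      refine ⟨by simp [blockRun, prefixOps, Op.run], ?_, ?_, ?_, ?_, ?_, ?_, ?_, ?_, ?_, ?_⟩
      · simp [blockRun, prefixOps, Op.run, CExp.eval, i4, i11, ← pow_add]
        congr 1
      · simp [blockRun, prefixOps, Op.run, i11]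
      · simp [blockRun, prefixOps, Op.run, i6]
      · simp [blockRun, prefixOps, Op.run, NExp.eval, CExp.eval, hn, h0, h1, i7, ← two_mul, hX,
          Finset.sum_range_succ]
      · simp [blockRun, prefixOps, Op.run, CExp.eval, i4, i6, i8, c1, Finset.sum_range_succ,
          correction]
      · simp [blockRun, prefixOps, Op.run, NExp.eval, CExp.eval, hn, h0, i9,
          Finset.sum_range_succ, iB k le_rfl (by omega), iB (n + k) (by omega) (by omega)]
      · intro j hj
        rw [hcm _ (by omega)]
        split_ifs with h
        · rw [show j = k by omega]
        · exact iU j (by omega)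
      · intro j hj
        rw [hcm _ (by omega), if_neg (by omega)]
        exact iX j hj
      · intro j hj
        rw [hrm _ (by omega)]
        split_ifs with h
        · rw [h]
        · exact iR j (by omega)
      · intro j hj hj'
        rw [hrm _ (by omega), if_neg (by omega)]
        exact iB j (by omega) hj')
  obtain ⟨-, -, i6, i7, i8, i9, iU, -, iR, -⟩ := h
  exact ⟨s', hr, hn, i6, i7, i8, i9, iU, iR⟩

/-- The vector left in memory by the program. -/
noncomputable def decoded (n : ℕ) (b : ℕ → ℝ) (i : ℕ) : ℝ :=
  (∑ j ∈ Finset.range (i + 1), negacyclicSol n b j).re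
    + (correctionCoeff n b * ∑ j ∈ Finset.range (i + 1), correction n j).re

theorem correct_runs {n O : ℕ} {s : State} {b : ℕ → ℝ} (h0 : s.nreg 0 = n) (h1 : s.nreg 1 = O)
    (hO : 6 * n ≤ O) (h3 : s.nreg 3 = 0) (h10 : s.creg 10 = correctionCoeff n b)
    (hU : ∀ j < n, s.cmem (O + 2 * j + 1) = ∑ i ∈ Finset.range (j + 1), correction n i)
    (hR : ∀ j < n, s.rmem j = (∑ i ∈ Finset.range (j + 1), negacyclicSol n b i).re) :
    ∃ s', Runs procs (forLoop 0 correctOps) s ((n + 1) * forCost correctOps) s' ∧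
      ∀ j < n, s'.rmem j = decoded n b j := by
  obtain ⟨s', hr, hn, h⟩ := forLoop_runs (procs := procs) (lim := 0) (by norm_num) (l := correctOps)
    (N := n) (s := s)
    (fun k s' => s'.creg 10 = correctionCoeff n b ∧
      (∀ j < n, s'.cmem (O + 2 * j + 1) = ∑ i ∈ Finset.range (j + 1), correction n i) ∧
      ∀ j < n, s'.rmem j = if j < k then decoded n b j
        else (∑ i ∈ Finset.range (j + 1), negacyclicSol n b i).re) h3 h0
    ⟨h10, hU, by simpa using hR⟩ (by
      rintro k hk s' hn ⟨i10, iU, iR⟩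
      refine ⟨by simp [blockRun, correctOps, Op.run], ?_, ?_, ?_⟩
      · simp [blockRun, correctOps, Op.run, i10]
      · intro j hj
        rw [← iU j hj]
        simp only [blockRun, correctOps, Op.run, State.cmem_setN, NExp.eval, hn]
        rw [State.cmem_storeR_of_ne]
        simp
        omega
      · intro j hj
        simp only [blockRun, correctOps, Op.run, State.rmem_setN, NExp.eval, hn, CExp.eval, i10]
        simp [h1, Function.update_apply, ← two_mul, iU k hk, iR k hk, iR j hj]
        by_cases h : j = k
        · subst h; simp [decoded]
        · rw [if_neg h]
          have : j ≤ k ↔ j < k := by omega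
          simp [this])
  refine ⟨s', hr, fun j hj => ?_⟩
  rw [h.2.2 j hj, if_pos hj]

def decoderProgram : Program := ⟨decoderMain, [polyMulProc]⟩

def decoderCost (n : ℕ) : ℕ :=
  let k := Nat.clog 2 (3 * n)
  (blockCost initOps + (sizeTest.cost + 1) + blockCost chirpInitOps + 2 * blockCost modulusOps
    + blockCost kernelInitOps + blockCost prefixInitOps + blockCost coeffOps + 2)
  + k * (sizeTest.cost + blockCost doubleOps + 1)
  + (n + 1) * (forCost chirpOps + forCost kernelOps + forCost prefixOps + forCost correctOps)
  + 2 * polyMulCost k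

theorem decoderProgram_runs (n : ℕ) (b : Fin (2 * n) → ℝ) :
    ∃ s', Runs decoderProgram.procs decoderProgram.main (inputState n b) (decoderCost n) s' ∧
      ∀ j < n, s'.rmem j = decoded n (inputState n b).rmem j := by
  set s := inputState n b with hs
  set β := s.rmem with hβ
  set k := Nat.clog 2 (3 * n) with hk
  have hkn : 3 * n ≤ 2 ^ k := Nat.le_pow_clog (by norm_num) _
  have hL : 2 ^ (k + 1) = 2 * 2 ^ k := by ring
  have n0 (x : ℕ) : s.nreg x = if x = 0 then n else 0 := rfl
  have m0 (x : ℕ) (hx : n ≤ x) : s.cmem x = 0 := by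
    apply Complex.ext
    · exact dif_neg (by omega)
    · exact dif_neg (by omega)
  have c0 : (⟨0, 0⟩ : ℂ) = 0 := rfl
  have c1 : (⟨1, 0⟩ : ℂ) = 1 := rfl
  have cI : (⟨0, 1⟩ : ℂ) = Complex.I := rfl
  clear_value s
  -- set-up
  have r1 := block_runs (procs := [polyMulProc]) initOps s
  set s1 := blockRun initOps s with hs1
  have n1 (x : ℕ) : s1.nreg x = if x = 0 then n else if x = 1 then 2 * n else if x = 2 then 2 else 0 := by
    simp [hs1, blockRun, initOps, Op.run, NExp.eval, Function.update_apply, n0, ← two_mul]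
    split_ifs <;> first | rfl | omega
  have m1 (x : ℕ) : s1.cmem x = s.cmem x := by simp [hs1, blockRun, initOps, Op.run]
  clear_value s1
  have r2 := size_runs (procs := [polyMulProc]) (s := s1) (n := n) (by simp [n1]) (by simp [n1])
  rw [← hk] at r2
  set s2 := s1.setN 2 (2 ^ (k + 1)) with hs2
  have n2 (x : ℕ) : s2.nreg x = if x = 0 then n else if x = 1 then 2 * n else
      if x = 2 then 2 ^ (k + 1) else 0 := by
    simp [hs2, Function.update_apply, n1]
    split_ifs <;> first | rfl | omega
  have m2 (x : ℕ) : s2.cmem x = s.cmem x := by simp [hs2, m1]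
  clear_value s2
  have r3 := block_runs (procs := [polyMulProc]) chirpInitOps s2
  set s3 := blockRun chirpInitOps s2 with hs3
  have n3 (x : ℕ) : s3.nreg x = s2.nreg x := by
    simp [hs3, blockRun, chirpInitOps, Op.run, NExp.eval, Function.update_apply]
    rintro rfl; simp [n2]
  have m3 (x : ℕ) : s3.cmem x = s.cmem x := by simp [hs3, blockRun, chirpInitOps, Op.run, m2]
  obtain ⟨s4, r4, n4, c411, c46, a4, b4, a4', b4', m4⟩ := chirp_runs (procs := [polyMulProc]) (s := s3) (n := n)
    (by simp [n3, n2]) (by simp [n3, n2]) (fun x hx => by rw [m3, m0 x (by omega)])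
    (by simp [n3, n2]) (by simp [hs3, blockRun, chirpInitOps, Op.run, CExp.eval, c1])
    (by simp [hs3, blockRun, chirpInitOps, Op.run, CExp.eval, NExp.eval, n2, zeta])
    (by simp [hs3, blockRun, chirpInitOps, Op.run, CExp.eval, NExp.eval, n2, zeta, sq])
    (by simp [hs3, blockRun, chirpInitOps, Op.run, CExp.eval, c0])
  clear_value s3
  -- the chirp transform
  have r5 := block_runs (procs := [polyMulProc]) modulusOps s4
  set s5 := blockRun modulusOps s4 with hs5
  have n5 (x : ℕ) (hx : x ≠ 3) : s5.nreg x = s2.nreg x := by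
    simp [hs5, blockRun, modulusOps, Op.run, n4, hx, n3]
  have m5 (x : ℕ) : s5.cmem x = s4.cmem x := by simp [hs5, blockRun, modulusOps, Op.run]
  have c5 (x : ℕ) : s5.creg x = if x = 1 then Complex.I else s4.creg x := by
    simp [hs5, blockRun, modulusOps, Op.run, CExp.eval, cI]
  clear_value s5
  obtain ⟨s6, r6, n6, c6, m6⟩ := polyMul_runs k (s := s5) (by simp [n5, n2]) (by simp [c5])
  have k6 (i : ℕ) (hi : i < n) : s6.cmem (2 * n + 2 * (n + i)) = ∑ j ∈ Finset.range n,
      invSqrtEig n j * zeta n ^ (j * j) * chirp n (n + i - j) := by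
    rw [m6, c5, if_pos rfl, n5 _ (by norm_num), n2, if_neg (by norm_num), if_pos rfl,
      funext m5, polyMul_eq_sum hkn (by simp) (fun j hj _ => a4' j hj) (fun j hj _ => b4' j hj) hi]
    refine Finset.sum_congr rfl fun j hj => ?_
    have := Finset.mem_range.1 hj
    rw [a4 j this, b4 _ (by omega) (by omega)]
  have u6 (x : ℕ) (hx : x < 2 * n ∨ 2 * n + 2 ^ (k + 1) ≤ x) : s6.cmem x = s4.cmem x := by
    rw [m6, polyMul_of_notMem _ _ _ _ _ (by simpa [n5, n2] using hx), m5]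
  have r7 := block_runs (procs := [polyMulProc]) kernelInitOps s6
  set s7 := blockRun kernelInitOps s6 with hs7
  have n7 (x : ℕ) : s7.nreg x = if x = 0 then n else if x = 1 then 2 * n + 2 ^ (k + 1) else
      if x = 2 then 2 ^ (k + 1) else if x = 4 then 2 * n else 0 := by
    by_cases h3 : x = 3
    · simp [hs7, blockRun, kernelInitOps, Op.run, NExp.eval, h3]
    · simp [hs7, blockRun, kernelInitOps, Op.run, NExp.eval, Function.update_apply, n6, n5, n2, h3]
      split_ifs <;> first | rfl | omega
  have m7 (x : ℕ) : s7.cmem x = s6.cmem x := by simp [hs7, blockRun, kernelInitOps, Op.run]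
  obtain ⟨s8, r8, n8, c86, a8, b8, a8', b8', m8⟩ := kernel_runs (procs := [polyMulProc]) (s := s7) (n := n)
    (O := 2 * n + 2 ^ (k + 1)) (b := β)
    (by simp [n7]) (by simp [n7]) (by simp [n7]) (by omega)
    -- The second block lies beyond the first, so it is still zero: neither the chirp loop nor the
    -- product has reached it.
    (fun x hx => by
      rw [m7, u6 _ (.inr hx)]
      obtain ⟨j, hj | hj⟩ : ∃ j, x = 2 * n + 2 * j ∨ x = 2 * n + 2 * j + 1 :=
        ⟨(x - 2 * n) / 2, by omega⟩
      · rw [hj]; exact a4' j (by omega)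
      · rw [hj]; exact b4' j (by omega))
    (by simp [n7]) (by simp [hs7, blockRun, kernelInitOps, Op.run, CExp.eval, c1])
    (by simp [hs7, blockRun, kernelInitOps, Op.run, CExp.eval, c6, c5, c411])
    (by simp [hs7, blockRun, kernelInitOps, Op.run, c6, c5, c411])
    (by simp [hs7, blockRun, kernelInitOps, Op.run, c6, c5, c46])
    (fun i hi => by rw [m7, k6 i hi])
    (fun i hi => State.rmem_eq_of_cmem_eq (by
      rw [m7, u6 _ (.inl (by omega)), m4 _ (by omega), m3]))
  clear_value s7
  -- the negacyclic convolution
  have r9 := block_runs (procs := [polyMulProc]) modulusOps s8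
  set s9 := blockRun modulusOps s8 with hs9
  have n9 (x : ℕ) (hx : x ≠ 3) : s9.nreg x = s7.nreg x := by
    simp [hs9, blockRun, modulusOps, Op.run, n8, hx]
  have m9 (x : ℕ) : s9.cmem x = s8.cmem x := by simp [hs9, blockRun, modulusOps, Op.run]
  have c9 (x : ℕ) : s9.creg x = if x = 1 then Complex.I else s8.creg x := by
    simp [hs9, blockRun, modulusOps, Op.run, CExp.eval, cI]
  clear_value s9
  obtain ⟨s10, r10, n10, c10, m10⟩ := polyMul_runs k (s := s9) (by simp [n9, n7]) (by simp [c9])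
  have k10 (i : ℕ) (hi : i < n) :
      s10.cmem (2 * n + 2 ^ (k + 1) + 2 * (n + i)) = negacyclicSol n β i := by
    rw [m10, c9, if_pos rfl, n9 _ (by norm_num), n7, if_neg (by norm_num), if_pos rfl,
      funext m9, polyMul_eq_sum hkn (by simp) (fun j hj _ => a8' j hj) (fun j hj _ => b8' j hj) hi]
    refine Finset.sum_congr rfl fun j hj => ?_
    have := Finset.mem_range.1 hj
    rw [a8 j this, b8 _ (by omega)]
  have u10 (x : ℕ) (hx : x < 2 * n) : s10.rmem x = β x := by
    rw [← m8 x hx]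
    refine State.rmem_eq_of_cmem_eq ?_
    rw [m10, polyMul_of_notMem _ _ _ _ _ (.inl (by simp [n9, n7]; omega)), m9]
  -- prefix sums and the correction
  have r11 := block_runs (procs := [polyMulProc]) prefixInitOps s10
  set s11 := blockRun prefixInitOps s10 with hs11
  have n11 (x : ℕ) : s11.nreg x = s7.nreg x := by
    by_cases h3 : x = 3
    · simp [hs11, blockRun, prefixInitOps, Op.run, NExp.eval, h3, n7]
    · simp [hs11, blockRun, prefixInitOps, Op.run, NExp.eval, n10, n9, h3]
  obtain ⟨s12, r12, n12, c126, c127, c128, c129, m12, v12⟩ := prefix_runs (procs := [polyMulProc])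
    (s := s11) (n := n) (O := 2 * n + 2 ^ (k + 1)) (b := β) (by simp [n11, n7]) (by simp [n11, n7])
    (by omega) (by simp [n11, n7])
    (by simp [hs11, blockRun, prefixInitOps, Op.run, CExp.eval, NExp.eval, n10, n9, n7, zeta])
    (by simp [hs11, blockRun, prefixInitOps, Op.run, CExp.eval, NExp.eval, n10, n9, n7, zeta, sq])
    (by simp [hs11, blockRun, prefixInitOps, Op.run, c10, c9, c86])
    (by simp [hs11, blockRun, prefixInitOps, Op.run, CExp.eval, c0])
    (by simp [hs11, blockRun, prefixInitOps, Op.run, CExp.eval, c0])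
    (by simp [hs11, blockRun, prefixInitOps, Op.run, CExp.eval, c0])
    (fun i hi => by rw [← k10 i hi]; simp [hs11, blockRun, prefixInitOps, Op.run])
    (fun i hi => by rw [← u10 i hi]; simp [hs11, blockRun, prefixInitOps, Op.run])
  clear_value s11
  have r13 := block_runs (procs := [polyMulProc]) coeffOps s12
  set s13 := blockRun coeffOps s12 with hs13
  have n13 (x : ℕ) : s13.nreg x = s7.nreg x := by
    by_cases h3 : x = 3
    · simp [hs13, blockRun, coeffOps, Op.run, NExp.eval, h3, n7]
    · simp [hs13, blockRun, coeffOps, Op.run, NExp.eval, n12, n11, h3]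
  obtain ⟨s14, r14, v14⟩ := correct_runs (procs := [polyMulProc]) (s := s13) (n := n)
    (O := 2 * n + 2 ^ (k + 1)) (b := β) (by simp [n13, n7]) (by simp [n13, n7]) (by omega)
    (by simp [n13, n7])
    (by simp [hs13, blockRun, coeffOps, Op.run, CExp.eval, c1, c126, c127, c128, c129,
      correctionCoeff])
    (fun j hj => by rw [← m12 j hj]; simp [hs13, blockRun, coeffOps, Op.run])
    (fun j hj => by rw [← v12 j hj]; simp [hs13, blockRun, coeffOps, Op.run])
  refine ⟨s14, (r1.seq (r2.seq (r3.seq (r4.seq (r5.seq ((r6.call rfl).seq (r7.seq (r8.seq (r9.seq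
    ((r10.call rfl).seq (r11.seq (r12.seq (r13.seq r14))))))))))))).mono ?_, v14⟩
  simp only [decoderCost, ← hk, mul_add]
  omega

end RealRAM

/-! ### The Moore–Penrose inverse and the normal equations -/

namespace FFTMech

open scoped ComplexOrder in
/-- A solution of the normal equations of an injective matrix is given by its Moore–Penrose
inverse. -/
theorem pinv_mulVec_eq {m n : Type*} [Fintype m] [Fintype n] {A : Matrix m n ℂ} {x : n → ℂ}
    {b : m → ℂ} (hinj : ∀ v, A *ᵥ v = 0 → v = 0) (hx : Aᴴ *ᵥ (A *ᵥ x) = Aᴴ *ᵥ b) :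
    pinv A *ᵥ b = x := by
  have hA := pinv_spec A
  have h1 : Aᴴ * (A * pinv A) = Aᴴ := by
    rw [← hA.isHermitian_left.eq, ← conjTranspose_mul, hA.mul_mul_self]
  have h2 : (Aᴴ * A) *ᵥ (pinv A *ᵥ b - x) = 0 := by
    rw [mulVec_sub, mulVec_mulVec, Matrix.mul_assoc, h1, ← mulVec_mulVec, hx, sub_self]
  rw [conjTranspose_mul_self_mulVec_eq_zero] at h2
  exact sub_eq_zero.1 (hinj _ h2)

end FFTMech

namespace RealRAM

open Finset

/-! ### Roots of unity and the odd-frequency transform -/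

theorem zeta_ne_zero (n : ℕ) : zeta n ≠ 0 := Complex.exp_ne_zero _

theorem zeta_pow_eq_exp (n k : ℕ) :
    zeta n ^ k = Complex.exp (((Real.pi * k / n : ℝ) : ℂ) * Complex.I) := by
  rw [zeta, ← Complex.exp_nat_mul]
  congr 1
  push_cast
  ring

theorem conj_zeta_pow (n k : ℕ) : (starRingEnd ℂ) (zeta n ^ k) = (zeta n ^ k)⁻¹ := by
  rw [zeta_pow_eq_exp, ← Complex.exp_conj, ← Complex.exp_neg]
  simp

theorem zeta_pow_self {n : ℕ} (hn : 0 < n) : zeta n ^ n = -1 := by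
  have : (n : ℝ) ≠ 0 := by positivity
  rw [zeta_pow_eq_exp, mul_div_assoc, div_self this, mul_one, Complex.exp_pi_mul_I]

theorem isPrimitiveRoot_zeta {n : ℕ} (hn : 0 < n) : IsPrimitiveRoot (zeta n) (2 * n) := by
  have h := Complex.isPrimitiveRoot_exp (2 * n) (by omega)
  convert h using 1
  rw [zeta]
  congr 1
  have : (n : ℂ) ≠ 0 := by exact_mod_cast hn.ne'
  push_cast
  field_simp

theorem im_zeta_pow_pos {n k : ℕ} (hk : 0 < k) (hkn : k < n) : 0 < (zeta n ^ k).im := by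
  rw [zeta_pow_eq_exp, Complex.exp_ofReal_mul_I_im]
  have hn : (0 : ℝ) < n := by exact_mod_cast hk.trans hkn
  apply Real.sin_pos_of_pos_of_lt_pi
  · positivity
  · rw [div_lt_iff₀ hn]
    gcongr

theorem sum_pow_eq_zero {z : ℂ} {n : ℕ} (hz : z ^ n = 1) (h1 : z ≠ 1) :
    ∑ j ∈ range n, z ^ j = 0 := by
  rw [geom_sum_eq h1, hz, sub_self, zero_div]

/-- Orthogonality of the characters of odd frequency. -/
theorem sum_odd_freq {n : ℕ} (hn : 0 < n) {m a : ℕ} (hm : m < n) (ha : a < n) :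
    ∑ j ∈ range n, zeta n ^ ((2 * j + 1) * m) * (zeta n ^ ((2 * j + 1) * a))⁻¹
      = if m = a then (n : ℂ) else 0 := by
  have hz := zeta_ne_zero n
  split_ifs with h
  · subst h
    simp [mul_inv_cancel₀ (pow_ne_zero _ hz)]
  · have hw : ∀ j, zeta n ^ ((2 * j + 1) * m) * (zeta n ^ ((2 * j + 1) * a))⁻¹
        = zeta n ^ m * (zeta n ^ a)⁻¹ * (zeta n ^ (2 * m) * (zeta n ^ (2 * a))⁻¹) ^ j := by
      intro j
      rw [mul_pow, inv_pow, ← pow_mul, ← pow_mul]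
      field_simp
      ring
    simp only [hw, ← mul_sum]
    rw [sum_pow_eq_zero, mul_zero]
    · rw [mul_pow, inv_pow, ← pow_mul, ← pow_mul, mul_right_comm 2 m, mul_right_comm 2 a,
        pow_mul _ (2 * n), pow_mul _ (2 * n), (isPrimitiveRoot_zeta hn).pow_eq_one]
      simp
    · intro h1
      have h2 := (isPrimitiveRoot_zeta hn).pow_inj (i := 2 * m) (j := 2 * a) (by omega) (by omega)
        ((mul_inv_eq_one₀ (pow_ne_zero _ hz)).1 h1)
      omega

/-- For `i ≠ j` the ratio of the geometric sum has `n`-th power `(-1) (-1)⁻¹ = 1` and is not `1`, as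
distinct odd exponents below `2n` give distinct powers. -/
theorem sum_odd_index {n : ℕ} (hn : 0 < n) {i j : ℕ} (hi : i < n) (hj : j < n) :
    ∑ m ∈ range n, zeta n ^ ((2 * i + 1) * m) * (zeta n ^ ((2 * j + 1) * m))⁻¹
      = if i = j then (n : ℂ) else 0 := by
  have hz := zeta_ne_zero n
  split_ifs with h
  · subst h
    simp [mul_inv_cancel₀ (pow_ne_zero _ hz)]
  · simp only [pow_mul, ← inv_pow, ← mul_pow]
    refine sum_pow_eq_zero ?_ fun h1 => ?_
    · rw [inv_pow, mul_pow, inv_pow, ← pow_mul, ← pow_mul, mul_comm _ n, mul_comm _ n, pow_mul,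
        pow_mul, zeta_pow_self hn, Odd.neg_one_pow ⟨i, rfl⟩, Odd.neg_one_pow ⟨j, rfl⟩]
      norm_num
    · rw [inv_pow] at h1
      have h2 := (isPrimitiveRoot_zeta hn).pow_inj (i := 2 * i + 1) (j := 2 * j + 1) (by omega)
        (by omega) ((mul_inv_eq_one₀ (pow_ne_zero _ hz)).1 h1)
      omega

theorem sum_all_freq {n : ℕ} (hn : 0 < n) {m a : ℕ} (hm : m < 2 * n) (ha : a < 2 * n) :
    ∑ k ∈ range (2 * n), (zeta n ^ (m * k))⁻¹ * zeta n ^ (a * k)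
      = if m = a then ((2 * n : ℕ) : ℂ) else 0 := by
  have hz := zeta_ne_zero n
  split_ifs with h
  · subst h
    simp [inv_mul_cancel₀ (pow_ne_zero _ hz)]
  · simp only [pow_mul, ← inv_pow, ← mul_pow]
    refine sum_pow_eq_zero ?_ fun h1 => ?_
    · rw [inv_pow, mul_pow, inv_pow, ← pow_mul, ← pow_mul, mul_comm m, mul_comm a,
        pow_mul _ (2 * n), pow_mul _ (2 * n), (isPrimitiveRoot_zeta hn).pow_eq_one]
      simp
    · rw [inv_pow] at h1
      exact h ((isPrimitiveRoot_zeta hn).pow_inj (by omega) (by omega)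
        ((inv_mul_eq_one₀ (pow_ne_zero _ hz)).1 h1))

/-- The odd-frequency transform. -/
noncomputable def oddDFT (n : ℕ) (x : ℕ → ℂ) (j : ℕ) : ℂ :=
  ∑ a ∈ range n, x a * (zeta n ^ ((2 * j + 1) * a))⁻¹

theorem oddDFT_of_eq_sum {n : ℕ} (hn : 0 < n) {x y : ℕ → ℂ}
    (h : ∀ m < n, x m = (∑ i ∈ range n, y i * zeta n ^ ((2 * i + 1) * m)) / n) {j : ℕ} (hj : j < n) :
    oddDFT n x j = y j := by
  have hn' : (n : ℂ) ≠ 0 := by exact_mod_cast hn.ne'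
  calc oddDFT n x j
      = ∑ m ∈ range n, ∑ i ∈ range n, y i / n *
          (zeta n ^ ((2 * i + 1) * m) * (zeta n ^ ((2 * j + 1) * m))⁻¹) := by
        refine sum_congr rfl fun m hm => ?_
        rw [h m (mem_range.1 hm), sum_div, sum_mul]
        exact sum_congr rfl fun i _ => by ring
    _ = ∑ i ∈ range n, y i / n * if i = j then (n : ℂ) else 0 := by
        rw [sum_comm]
        refine sum_congr rfl fun i hi => ?_
        rw [← mul_sum, sum_odd_index hn (mem_range.1 hi) hj]
    _ = y j := by simp [hj, hn']

theorem sum_oddDFT {n : ℕ} (hn : 0 < n) (x : ℕ → ℂ) {m : ℕ} (hm : m < n) :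
    ∑ j ∈ range n, zeta n ^ ((2 * j + 1) * m) * oddDFT n x j = n * x m := by
  calc ∑ j ∈ range n, zeta n ^ ((2 * j + 1) * m) * oddDFT n x j
      = ∑ j ∈ range n, ∑ a ∈ range n, x a *
          (zeta n ^ ((2 * j + 1) * m) * (zeta n ^ ((2 * j + 1) * a))⁻¹) := by
        refine sum_congr rfl fun j hj => ?_
        rw [oddDFT, mul_sum]
        exact sum_congr rfl fun i _ => by ring
    _ = ∑ a ∈ range n, x a * if m = a then (n : ℂ) else 0 := by
        rw [sum_comm]
        refine sum_congr rfl fun a ha => ?_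
        rw [← mul_sum, sum_odd_freq hn hm (mem_range.1 ha)]
    _ = n * x m := by simp [hm, mul_comm]

/-! ### Eigenvalues -/

/-- The eigenvalue at frequency `2j + 1`. -/
noncomputable def oddEig (n j : ℕ) : ℂ := oddDFT n (fun _ => 1) j

/-- A geometric sum with ratio `q = ζ ^ (-(2j + 1))` and `q ^ n = -1` equals `2 / (1 - q)`. -/
theorem oddEig_inv {n j : ℕ} (hn : 0 < n) :
    (oddEig n j)⁻¹ = (1 - (zeta n ^ (2 * j + 1))⁻¹) / 2 := by
  have hz := zeta_ne_zero n
  have hne : (zeta n ^ (2 * j + 1))⁻¹ ≠ 1 := by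
    rw [ne_eq, inv_eq_one, (isPrimitiveRoot_zeta hn).pow_eq_one_iff_dvd]
    -- The even order `2n` cannot divide an odd exponent.
    rintro ⟨c, hc⟩
    have := Nat.mul_assoc 2 n c
    omega
  rw [oddEig, oddDFT]
  simp only [one_mul, pow_mul, ← inv_pow]
  simp only [inv_pow] at hne ⊢
  have h3 : ∑ i ∈ range n, ((zeta n ^ (2 * j + 1)) ^ i)⁻¹
      = ∑ i ∈ range n, ((zeta n ^ (2 * j + 1))⁻¹) ^ i := by simp
  have h4 : ((zeta n ^ (2 * j + 1))⁻¹) ^ n = -1 := by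
    rw [inv_pow, ← pow_mul, mul_comm, pow_mul, zeta_pow_self hn]
    simp [pow_add]
  rw [h3, geom_sum_eq hne, h4, inv_div, ← neg_div_neg_eq]
  norm_num

theorem re_oddEig_inv_pos {n j : ℕ} (hn : 0 < n) : 0 < ((oddEig n j)⁻¹).re := by
  have hz := zeta_ne_zero n
  have h1 : (zeta n ^ (2 * j + 1)).re < 1 := by
    refine lt_of_le_of_ne ?_ fun h => ?_
    · rw [zeta_pow_eq_exp, Complex.exp_ofReal_mul_I_re]
      exact Real.cos_le_one _
    · have h2 : zeta n ^ (2 * j + 1) = 1 := by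
        have h3 : ‖zeta n ^ (2 * j + 1)‖ = 1 := by
          rw [zeta_pow_eq_exp, Complex.norm_exp_ofReal_mul_I]
        apply Complex.ext
        · simpa using h
        · have := Complex.sq_norm (zeta n ^ (2 * j + 1))
          rw [h3, Complex.normSq_apply, h] at this
          simpa using this
      rw [(isPrimitiveRoot_zeta hn).pow_eq_one_iff_dvd] at h2
      obtain ⟨c, hc⟩ := h2
      have := Nat.mul_assoc 2 n c
      omega
  rw [oddEig_inv hn, ← conj_zeta_pow]
  simp only [Complex.div_ofNat_re, Complex.sub_re, Complex.one_re, Complex.conj_re]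
  linarith

theorem invSqrtEig_eq {n j : ℕ} (hn : 0 < n) :
    invSqrtEig n j = csqrt (oddEig n j)⁻¹ := by
  rw [invSqrtEig, oddEig_inv hn, conj_zeta_pow]

theorem eq_of_mul_self_eq {w v : ℂ} (h : w * w = v * v) (hw : 0 < w.re) (hv : 0 < v.re) : w = v := by
  rcases mul_self_eq_mul_self_iff.1 h with h | h
  · exact h
  · rw [h, Complex.neg_re] at hw
    linarith

theorem sqrt_mul_self (z : ℂ) : Complex.sqrt z * Complex.sqrt z = z := by
  rw [Complex.sqrt, ← sq]
  exact_mod_cast Complex.cpow_nat_inv_pow z two_ne_zero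

theorem re_sqrt_pos {z : ℂ} (hz : 0 < z.re) : 0 < (Complex.sqrt z).re := by
  rw [Complex.sqrt, Complex.cpow_inv_two_re]
  have := norm_nonneg z
  exact Real.sqrt_pos.2 (by linarith)

theorem csqrt_eq_sqrt {z : ℂ} (hz : 0 < z.re) : csqrt z = Complex.sqrt z :=
  eq_of_mul_self_eq (by rw [csqrt_mul_self (.inl hz), sqrt_mul_self]) (csqrt_re_pos (.inl hz))
    (re_sqrt_pos hz)

theorem re_inv_pos {z : ℂ} (hz : 0 < z.re) : 0 < (z⁻¹).re := by
  rw [Complex.inv_re]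
  exact div_pos hz (Complex.normSq_pos.2 fun h => by simp [h] at hz)

/-- Inversion preserves the right half plane, so `csqrt (1/λ)` and `1/√λ` are square roots of the
same number with positive real part, hence equal. -/
theorem sqrt_oddEig_mul_invSqrtEig {n j : ℕ} (hn : 0 < n) :
    Complex.sqrt (oddEig n j) * invSqrtEig n j = 1 := by
  have h1 := re_oddEig_inv_pos (j := j) hn
  have h2 : 0 < (oddEig n j).re := by simpa using re_inv_pos h1
  have h3 : (0 : ℝ) < ((invSqrtEig n j)⁻¹).re := by
    rw [invSqrtEig_eq hn]
    exact re_inv_pos (csqrt_re_pos (.inl h1))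
  have h4 : Complex.sqrt (oddEig n j) = (invSqrtEig n j)⁻¹ := by
    refine eq_of_mul_self_eq ?_ (re_sqrt_pos h2) h3
    rw [sqrt_mul_self, ← mul_inv, invSqrtEig_eq hn, csqrt_mul_self (.inl h1), inv_inv]
  rw [h4, inv_mul_cancel₀]
  intro h
  simp [h] at h3

/-! ### The computed vectors -/

theorem chirp_eq {n d j : ℕ} (hj : j < n) :
    chirp n (n + d - j) = zeta n ^ (-((d : ℤ) - j) ^ 2) := by
  have key (e : ℕ) : (starRingEnd ℂ) (zeta n ^ (e * e)) = zeta n ^ (-((e : ℤ)) ^ 2) := by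
    rw [conj_zeta_pow, _root_.zpow_neg, sq]
    exact_mod_cast rfl
  unfold chirp
  split_ifs with h
  · rw [key, show n + d - j - n = d - j by omega, Nat.cast_sub (by omega)]
  · rw [key, show n - (n + d - j) = j - d by omega, Nat.cast_sub (by omega)]
    congr 1
    ring

theorem kernel_eq (n d : ℕ) :
    kernel n d = (∑ j ∈ range n, invSqrtEig n j * zeta n ^ ((2 * j + 1) * d)) / n := by
  have hz := zeta_ne_zero n
  rw [kernel, mul_sum]
  congr 1
  refine sum_congr rfl fun j hj => ?_
  rw [chirp_eq (mem_range.1 hj)]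
  have : zeta n ^ (d * d + d) * (zeta n ^ (j * j) * zeta n ^ (-((d : ℤ) - j) ^ 2))
      = zeta n ^ ((2 * j + 1) * d) := by
    rw [← zpow_natCast, ← zpow_natCast, ← zpow_natCast, ← zpow_add₀ hz, ← zpow_add₀ hz]
    congr 1
    push_cast
    ring
  rw [← this]
  ring

/-- The offset index `n + m - a` encodes the difference `m - a` of either sign; since `ζ ^ ((2j + 1)
n) = -1`, shifting a negative difference by `n` costs exactly the sign in `kernelExt`. -/
theorem kernelExt_eq {n : ℕ} (hn : 0 < n) {m a : ℕ} (ha : a < n) :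
    kernelExt n (n + m - a) = (∑ j ∈ range n,
      invSqrtEig n j * (zeta n ^ ((2 * j + 1) * m) * (zeta n ^ ((2 * j + 1) * a))⁻¹)) / n := by
  have hz := zeta_ne_zero n
  unfold kernelExt
  split_ifs with h
  · rw [kernel_eq]
    congr 1
    refine sum_congr rfl fun j _ => ?_
    rw [← pow_sub₀ _ hz (by gcongr; omega), ← Nat.mul_sub, show n + m - a - n = m - a by omega]
  · rw [kernel_eq, ← neg_div, ← sum_neg_distrib]
    congr 1
    refine sum_congr rfl fun j _ => ?_
    have : zeta n ^ ((2 * j + 1) * (n + m - a)) * zeta n ^ ((2 * j + 1) * a)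
        = - zeta n ^ ((2 * j + 1) * m) := by
      rw [← pow_add, ← mul_add, show n + m - a + a = n + m by omega, mul_add, pow_add,
        mul_comm _ n, pow_mul, zeta_pow_self hn]
      simp [pow_add]
    rw [← neg_eq_iff_eq_neg.2 this]
    field_simp

/-! ### Reality of the computed quantities -/

theorem csqrt_conj (z : ℂ) : csqrt ((starRingEnd ℂ) z) = (starRingEnd ℂ) (csqrt z) := by
  apply Complex.ext <;> simp [csqrt, neg_div]

/-- Conjugation exchanges the frequencies `2j + 1` and `2n - (2j + 1)`, which is the reflection `j ↦
n - 1 - j` of the sum. -/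
theorem conj_kernel {n : ℕ} (hn : 0 < n) (d : ℕ) : (starRingEnd ℂ) (kernel n d) = kernel n d := by
  have hz := zeta_ne_zero n
  rw [kernel_eq, map_div₀, map_sum, Complex.conj_natCast, ← sum_range_reflect]
  congr 1
  refine sum_congr rfl fun j hj => ?_
  have hj := mem_range.1 hj
  have h1 : zeta n ^ (2 * (n - 1 - j) + 1) * zeta n ^ (2 * j + 1) = 1 := by
    rw [← pow_add, show 2 * (n - 1 - j) + 1 + (2 * j + 1) = 2 * n by omega,
      (isPrimitiveRoot_zeta hn).pow_eq_one]
  have h2 : (starRingEnd ℂ) (zeta n ^ (2 * (n - 1 - j) + 1)) = zeta n ^ (2 * j + 1) := by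
    rw [conj_zeta_pow]
    exact inv_eq_of_mul_eq_one_right h1
  have h3 : (starRingEnd ℂ) (invSqrtEig n (n - 1 - j)) = invSqrtEig n j := by
    rw [invSqrtEig, invSqrtEig, h2, ← csqrt_conj]
    congr 1
    rw [map_div₀, map_sub, map_one, Complex.conj_ofNat]
  rw [map_mul, h3, pow_mul, pow_mul, map_pow, h2]

theorem conj_kernelExt {n : ℕ} (hn : 0 < n) (e : ℕ) :
    (starRingEnd ℂ) (kernelExt n e) = kernelExt n e := by
  unfold kernelExt
  split_ifs <;> simp [conj_kernel hn]

theorem conj_negacyclicSol {n : ℕ} (hn : 0 < n) (b : ℕ → ℝ) (m : ℕ) :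
    (starRingEnd ℂ) (negacyclicSol n b m) = negacyclicSol n b m := by
  simp [negacyclicSol, conj_kernelExt hn]

theorem conj_correction (n m : ℕ) : (starRingEnd ℂ) (correction n m) = correction n m := by
  simp [correction]

theorem csqrt_natCast (n : ℕ) : csqrt n = (√n : ℝ) := by
  apply Complex.ext <;> simp [csqrt]

theorem conj_correctionCoeff {n : ℕ} (hn : 0 < n) (b : ℕ → ℝ) :
    (starRingEnd ℂ) (correctionCoeff n b) = correctionCoeff n b := by
  simp [correctionCoeff, conj_correction, conj_negacyclicSol hn, csqrt_natCast]

/-- The odd transform turns the negacyclic convolution into a product. -/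
theorem oddDFT_negacyclicSol {n : ℕ} (hn : 0 < n) (b : ℕ → ℝ) {j : ℕ} (hj : j < n) :
    oddDFT n (negacyclicSol n b) j
      = invSqrtEig n j * oddDFT n (fun a => (b a : ℂ) - b (n + a)) j := by
  refine oddDFT_of_eq_sum hn
    (y := fun j => invSqrtEig n j * oddDFT n (fun a => (b a : ℂ) - b (n + a)) j) (fun m hm => ?_) hj
  calc negacyclicSol n b m
      = ∑ a ∈ range n, ∑ i ∈ range n, ((b a : ℂ) - b (n + a)) * (invSqrtEig n i *
          (zeta n ^ ((2 * i + 1) * m) * (zeta n ^ ((2 * i + 1) * a))⁻¹)) / n := by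
        refine sum_congr rfl fun a ha => ?_
        rw [kernelExt_eq hn (mem_range.1 ha), mul_div_assoc', mul_sum, sum_div]
    _ = _ := by
        rw [sum_comm, sum_div]
        refine sum_congr rfl fun i _ => ?_
        simp only [oddDFT]
        rw [mul_sum, sum_mul, sum_div]
        exact sum_congr rfl fun a _ => by ring

/-! ### The direction of the rank-one correction -/

theorem zeta_two_mul_sq (n : ℕ) : zeta (n + n) ^ 2 = zeta n := by
  rw [zeta, zeta, ← Complex.exp_nat_mul]
  congr 1
  rcases eq_or_ne n 0 with rfl | hn
  · simp
  · have : (n : ℂ) ≠ 0 := by exact_mod_cast hn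
    push_cast
    field_simp
    norm_num

theorem sub_inv_zeta (N k : ℕ) :
    zeta N ^ k - (zeta N ^ k)⁻¹ = 2 * Complex.I * ((zeta N ^ k).im : ℂ) := by
  rw [← conj_zeta_pow, Complex.sub_conj]
  push_cast
  ring

/-- The exponents combine to `(2i + 1) (2m + 1)` over a root of order `4n`. With `z` the `(2m +
1)`-st power of that root, the sum is geometric of ratio `z²`; `z ^ (2n) = -1` and `z² - 1 = 2i z Im
z` give its value. -/
theorem correction_eq_sum {n m : ℕ} (hm : m < n) :
    correction n m = (∑ i ∈ range n,
      -Complex.I * zeta (n + n) ^ (2 * i + 1) * zeta n ^ ((2 * i + 1) * m)) / n := by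
  have hn : 0 < n := by omega
  have hpos := im_zeta_pow_pos (n := n + n) (k := 2 * m + 1) (by omega) (by omega)
  have hz0 : zeta (n + n) ^ (2 * m + 1) ≠ 0 := pow_ne_zero _ (zeta_ne_zero _)
  have hsub := sub_inv_zeta (n + n) (2 * m + 1)
  have hzn : (zeta (n + n) ^ (2 * m + 1)) ^ (2 * n) = -1 := by
    rw [← pow_mul, mul_comm, two_mul n, pow_mul, zeta_pow_self (by omega),
      Odd.neg_one_pow ⟨m, rfl⟩]
  have hterm (i : ℕ) : zeta (n + n) ^ (2 * i + 1) * zeta n ^ ((2 * i + 1) * m)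
      = zeta (n + n) ^ (2 * m + 1) * ((zeta (n + n) ^ (2 * m + 1)) ^ 2) ^ i := by
    rw [← zeta_two_mul_sq n]
    ring
  have hne : ((zeta (n + n) ^ (2 * m + 1)).im : ℂ) ≠ 0 := by exact_mod_cast hpos.ne'
  have hn' : (n : ℂ) ≠ 0 := by exact_mod_cast hn.ne'
  simp only [mul_assoc, hterm]
  rw [correction]
  generalize zeta (n + n) ^ (2 * m + 1) = z at *
  rw [← mul_sum, ← mul_sum]
  have h1 : z ^ 2 - 1 = z * (2 * Complex.I * (z.im : ℂ)) := by
    rw [← hsub]; field_simp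
  have h2 : z ^ 2 ≠ 1 := by
    rw [← sub_ne_zero, h1]
    simp [hz0, hne]
  rw [geom_sum_eq h2, ← pow_mul, hzn, h1]
  have hI := Complex.I_ne_zero
  field_simp
  norm_num

theorem oddDFT_correction {n j : ℕ} (hj : j < n) :
    oddDFT n (correction n) j = -Complex.I * zeta (n + n) ^ (2 * j + 1) :=
  oddDFT_of_eq_sum (y := fun i => -Complex.I * zeta (n + n) ^ (2 * i + 1)) (by omega)
    (fun m hm => correction_eq_sum hm) hj

/-- The defining property `|λ| û = λ`: in terms of the unit `z = exp (πi (2j + 1) / 2n)` one has `λ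
= -i z / Im z` with `Im z > 0`, so `λ / |λ| = -i z`. -/
theorem conj_sqrt_mul_sqrt_mul_oddDFT_correction {n j : ℕ} (hj : j < n) :
    (starRingEnd ℂ) (Complex.sqrt (oddEig n j)) * Complex.sqrt (oddEig n j)
      * oddDFT n (correction n) j = oddEig n j := by
  have hpos := im_zeta_pow_pos (n := n + n) (k := 2 * j + 1) (by omega) (by omega)
  have hz0 : zeta (n + n) ^ (2 * j + 1) ≠ 0 := pow_ne_zero _ (zeta_ne_zero _)
  have hsub := sub_inv_zeta (n + n) (2 * j + 1)
  have hinv := oddEig_inv (n := n) (j := j) (by omega)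
  have hnorm : ‖zeta (n + n) ^ (2 * j + 1)‖ = 1 := by
    rw [zeta_pow_eq_exp, Complex.norm_exp_ofReal_mul_I]
  have hne : ((zeta (n + n) ^ (2 * j + 1)).im : ℂ) ≠ 0 := by exact_mod_cast hpos.ne'
  rw [← zeta_two_mul_sq n, ← pow_mul, mul_comm 2 (2 * j + 1), pow_mul] at hinv
  rw [oddDFT_correction hj]
  generalize zeta (n + n) ^ (2 * j + 1) = z at *
  have hσ : oddEig n j = -Complex.I * z / (z.im : ℂ) := by
    have h1 : (oddEig n j)⁻¹ = z⁻¹ * (Complex.I * (z.im : ℂ)) := by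
      have h2 : Complex.I * (z.im : ℂ) = (z - z⁻¹) / 2 := by rw [hsub]; ring
      rw [hinv, h2]
      field_simp
    rw [← inv_inv (oddEig n j), h1, mul_inv, mul_inv, inv_inv, Complex.inv_I]
    ring
  have habs : (starRingEnd ℂ) (Complex.sqrt (oddEig n j)) * Complex.sqrt (oddEig n j)
      = 1 / (z.im : ℂ) := by
    have h1 : ‖Complex.sqrt (oddEig n j)‖ * ‖Complex.sqrt (oddEig n j)‖ = 1 / z.im := by
      rw [← norm_mul, sqrt_mul_self, hσ]
      simp [hnorm, abs_of_pos hpos]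
    rw [← Complex.normSq_eq_conj_mul_self, Complex.normSq_eq_norm_sq, sq, h1]
    push_cast
    rfl
  rw [habs, hσ]
  ring

/-- All sines involved are positive, so the denominator of the coefficient exceeds zero. -/
theorem one_add_sum_correction_ne_zero (n : ℕ) : 1 + ∑ j ∈ range n, correction n j ≠ 0 := by
  have h (j : ℕ) : correction n j = ((1 / (n * (zeta (n + n) ^ (2 * j + 1)).im) : ℝ) : ℂ) := by
    simp [correction]
  simp only [h]
  rw [← Complex.ofReal_sum, ← Complex.ofReal_one, ← Complex.ofReal_add]
  norm_cast
  refine (add_pos_of_pos_of_nonneg one_pos (sum_nonneg fun j hj => ?_)).ne'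
  have := mem_range.1 hj
  have := im_zeta_pow_pos (n := n + n) (k := 2 * j + 1) (by omega) (by omega)
  positivity


/-! ### The least-squares solution and its normal equations -/

open FFTMech

/-- The solution of the least-squares problem for the encoder. -/
noncomputable def leastSquares (n : ℕ) (b : ℕ → ℝ) (m : ℕ) : ℂ :=
  negacyclicSol n b m + correctionCoeff n b * correction n m

/-- The eigenvalue of the circulant matrix at frequency `k`. -/
noncomputable def eig (n k : ℕ) : ℂ := ∑ a ∈ range n, (zeta n ^ (k * a))⁻¹

theorem eig_zero (n : ℕ) : eig n 0 = n := by simp [eig]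

theorem eig_odd (n j : ℕ) : eig n (2 * j + 1) = oddEig n j := by simp [eig, oddEig, oddDFT]

/-- Here the ratio of the geometric sum is a nontrivial `n`-th root of unity. -/
theorem eig_even {n j : ℕ} (h0 : 0 < j) (hj : j < n) : eig n (2 * j) = 0 := by
  have hn : 0 < n := by omega
  simp only [eig, pow_mul _ (2 * j), ← inv_pow]
  refine sum_pow_eq_zero ?_ ?_
  · rw [inv_pow, inv_pow, ← pow_mul, mul_right_comm, pow_mul, (isPrimitiveRoot_zeta hn).pow_eq_one, one_pow,
      inv_one]
  · rw [inv_pow, inv_ne_one, ne_eq, (isPrimitiveRoot_zeta hn).pow_eq_one_iff_dvd]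
    exact Nat.not_dvd_of_pos_of_lt (by omega) (by omega)

theorem sum_range_two_mul (f : ℕ → ℂ) (n : ℕ) :
    ∑ k ∈ range (2 * n), f k = ∑ j ∈ range n, f (2 * j) + ∑ j ∈ range n, f (2 * j + 1) := by
  induction n with
  | zero => simp
  | succ n ih =>
    rw [mul_add, mul_one, sum_range_succ, sum_range_succ, ih, sum_range_succ, sum_range_succ]
    ring

theorem sum_range_two_mul_odd {n : ℕ} (hn : 0 < n) (b : ℕ → ℝ) (j : ℕ) :
    ∑ a ∈ range (2 * n), (b a : ℂ) * (zeta n ^ ((2 * j + 1) * a))⁻¹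
      = oddDFT n (fun a => (b a : ℂ) - b (n + a)) j := by
  rw [two_mul n, sum_range_add, ← sum_add_distrib, oddDFT]
  refine sum_congr rfl fun a _ => ?_
  have : zeta n ^ ((2 * j + 1) * (n + a)) = -zeta n ^ ((2 * j + 1) * a) := by
    rw [mul_add, pow_add, mul_comm _ n, pow_mul, zeta_pow_self hn, Odd.neg_one_pow ⟨j, rfl⟩,
      neg_one_mul]
  rw [this, inv_neg]
  ring

/-- This is the equation that determines `correctionCoeff`, rearranged. -/
theorem leastSquares_residual_zero {n : ℕ} (hn : 0 < n) (b : ℕ → ℝ) :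
    (starRingEnd ℂ) (Complex.sqrt n) * (Complex.sqrt n * ∑ a ∈ range n, leastSquares n b a
      - ∑ a ∈ range (2 * n), (b a : ℂ)) = -(n * correctionCoeff n b) := by
  have hn' : (0 : ℝ) < n := by exact_mod_cast hn
  have h1 := one_add_sum_correction_ne_zero n
  have h2 : Complex.sqrt n = csqrt n := (csqrt_eq_sqrt (by simpa using hn)).symm
  have h3 : csqrt n * csqrt n = n := csqrt_mul_self (.inl (by simpa using hn))
  have h4 : (starRingEnd ℂ) (csqrt n) = csqrt n := by rw [csqrt_natCast, Complex.conj_ofReal]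
  have h5 : csqrt n ≠ 0 := by
    intro h
    rw [h, mul_zero] at h3
    exact hn.ne' (by exact_mod_cast h3.symm)
  have h6 : ∑ a ∈ range (2 * n), (b a : ℂ) = ∑ a ∈ range n, ((b a : ℂ) + b (n + a)) := by
    rw [two_mul, sum_range_add, ← sum_add_distrib]
  rw [h2, h4, h6]
  simp only [leastSquares]
  rw [sum_add_distrib, ← mul_sum]
  have h7 : correctionCoeff n b * (1 + ∑ j ∈ range n, correction n j)
      = (∑ j ∈ range n, ((b j : ℂ) + b (n + j))) / csqrt n
        - ∑ j ∈ range n, negacyclicSol n b j := by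
    rw [correctionCoeff, div_mul_cancel₀ _ h1]
  generalize ∑ j ∈ range n, ((b j : ℂ) + b (n + j)) = s at *
  have h8 : s / csqrt n * (csqrt n * csqrt n) = s * csqrt n := by field_simp
  rw [h3] at h8
  linear_combination (∑ x ∈ range n, negacyclicSol n b x
    + correctionCoeff n b * ∑ i ∈ range n, correction n i) * h3 + n * h7 + h8

theorem oddDFT_add_mul (n : ℕ) (x y : ℕ → ℂ) (c : ℂ) (j : ℕ) :
    oddDFT n (fun m => x m + c * y m) j = oddDFT n x j + c * oddDFT n y j := by
  simp only [oddDFT, mul_sum, ← sum_add_distrib]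
  exact sum_congr rfl fun a _ => by ring

/-- The part `x₀` has zero residual at odd frequencies; only `|λ| c û = c λ` survives. -/
theorem leastSquares_residual_odd {n : ℕ} (hn : 0 < n) (b : ℕ → ℝ) {j : ℕ} (hj : j < n) :
    (starRingEnd ℂ) (Complex.sqrt (oddEig n j)) * (Complex.sqrt (oddEig n j) *
      oddDFT n (leastSquares n b) j - oddDFT n (fun a => (b a : ℂ) - b (n + a)) j)
      = correctionCoeff n b * oddEig n j := by
  have h1 := sqrt_oddEig_mul_invSqrtEig hn (j := j)
  have h2 := conj_sqrt_mul_sqrt_mul_oddDFT_correction hj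
  have h3 : oddDFT n (leastSquares n b) j = _ := oddDFT_add_mul n (negacyclicSol n b) _ _ j
  rw [h3, oddDFT_negacyclicSol hn b hj]
  linear_combination correctionCoeff n b * h2 + (starRingEnd ℂ) (Complex.sqrt (oddEig n j)) *
    oddDFT n (fun a => (b a : ℂ) - b (n + a)) j * h1

theorem leastSquares_normal {n : ℕ} (hn : 0 < n) (b : ℕ → ℝ) {m : ℕ} (hm : m < n) :
    ∑ k ∈ range (2 * n), (starRingEnd ℂ) (Complex.sqrt (eig n k)) * zeta n ^ (k * m) *
      (Complex.sqrt (eig n k) * ∑ a ∈ range n, leastSquares n b a * (zeta n ^ (k * a))⁻¹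
        - ∑ a ∈ range (2 * n), (b a : ℂ) * (zeta n ^ (k * a))⁻¹) = 0 := by
  rw [sum_range_two_mul]
  have heven : ∑ j ∈ range n, (starRingEnd ℂ) (Complex.sqrt (eig n (2 * j))) *
      zeta n ^ (2 * j * m) * (Complex.sqrt (eig n (2 * j)) *
        ∑ a ∈ range n, leastSquares n b a * (zeta n ^ (2 * j * a))⁻¹
        - ∑ a ∈ range (2 * n), (b a : ℂ) * (zeta n ^ (2 * j * a))⁻¹)
      = -(n * correctionCoeff n b) := by
    rw [sum_eq_single 0]
    · rw [← leastSquares_residual_zero hn b]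
      simp [eig_zero]
    · intro j hj h0
      rw [eig_even (by omega) (mem_range.1 hj)]
      simp
    · intro h
      exact absurd (mem_range.2 hn) h
  have hodd : ∑ j ∈ range n, (starRingEnd ℂ) (Complex.sqrt (eig n (2 * j + 1))) *
      zeta n ^ ((2 * j + 1) * m) * (Complex.sqrt (eig n (2 * j + 1)) *
        ∑ a ∈ range n, leastSquares n b a * (zeta n ^ ((2 * j + 1) * a))⁻¹
        - ∑ a ∈ range (2 * n), (b a : ℂ) * (zeta n ^ ((2 * j + 1) * a))⁻¹)
      = n * correctionCoeff n b := by
    -- The odd eigenvalues are the transform of the all-ones vector, so their inverse transform does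
    -- not depend on `m`.
    have h := sum_oddDFT hn (fun _ => 1) hm
    rw [mul_one] at h
    rw [← h, sum_mul]
    refine sum_congr rfl fun j hj => ?_
    rw [eig_odd, sum_range_two_mul_odd hn, mul_right_comm]
    have := leastSquares_residual_odd hn b (mem_range.1 hj)
    rw [oddDFT] at this
    rw [this, ← oddEig]
    ring
  rw [heven, hodd]
  ring

/-! ### The encoder in the frequency domain -/

theorem exp_eq_inv_zeta_pow (n k a : ℕ) :
    Complex.exp (-(2 * Real.pi * Complex.I * (k : ℂ) * (a : ℂ) / ((2 * n : ℕ) : ℂ)))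
      = (zeta n ^ (k * a))⁻¹ := by
  rw [zeta_pow_eq_exp, ← Complex.exp_neg]
  congr 1
  push_cast
  rcases eq_or_ne n 0 with rfl | hn
  · simp
  · have : (n : ℂ) ≠ 0 := by exact_mod_cast hn
    field_simp

theorem dftMatrix_apply (n : ℕ) (k a : Fin (2 * n)) :
    dftMatrix (2 * n) k a = ((√((2 * n : ℕ) : ℝ) : ℝ) : ℂ)⁻¹ * (zeta n ^ ((k : ℕ) * a))⁻¹ := by
  rw [dftMatrix, of_apply, exp_eq_inv_zeta_pow]

theorem dftVec_circVec (n : ℕ) (k : Fin (2 * n)) : dftVec (circVec n) k = eig n k := by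
  simp only [dftVec, circVec, exp_eq_inv_zeta_pow]
  rw [Fin.sum_univ_eq_sum_range
    (fun a => (if a < n then (1 : ℂ) else 0) * (zeta n ^ ((k : ℕ) * a))⁻¹)]
  generalize (k : ℕ) = k
  rw [two_mul, sum_range_add,
    eig, sum_congr rfl fun a ha => by rw [if_pos (mem_range.1 ha), one_mul],
    add_eq_left]
  exact sum_eq_zero fun a _ => by simp

theorem dftMatrix_mul_conjTranspose {n : ℕ} (hn : 0 < n) :
    dftMatrix (2 * n) * (dftMatrix (2 * n))ᴴ = 1 := by
  ext k l
  have h0 : ((√((2 * n : ℕ) : ℝ) : ℝ) : ℂ) * (√((2 * n : ℕ) : ℝ) : ℝ) = ((2 * n : ℕ) : ℂ) := by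
    rw [← Complex.ofReal_mul, Real.mul_self_sqrt (by positivity), Complex.ofReal_natCast]
  have h1 : ((2 * n : ℕ) : ℂ) ≠ 0 := by exact_mod_cast (by omega : 2 * n ≠ 0)
  rw [mul_apply]
  simp only [conjTranspose_apply, dftMatrix_apply, star_mul', star_inv₀, RCLike.star_def,
    conj_zeta_pow, inv_inv, Complex.conj_ofReal]
  rw [Fin.sum_univ_eq_sum_range (fun a => ((√((2 * n : ℕ) : ℝ) : ℝ) : ℂ)⁻¹ *
    (zeta n ^ ((k : ℕ) * a))⁻¹ * (((√((2 * n : ℕ) : ℝ) : ℝ) : ℂ)⁻¹ * zeta n ^ ((l : ℕ) * a)))]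
  simp only [mul_mul_mul_comm, ← mul_sum]
  rw [sum_all_freq hn k.2 l.2, ← mul_inv, h0, one_apply]
  by_cases h : k = l
  · rw [if_pos h, if_pos (congrArg _ h), inv_mul_cancel₀ h1]
  · rw [if_neg h, if_neg (fun h' => h (Fin.ext h')), mul_zero]

/-- The encoder in the frequency domain. -/
noncomputable def spectralEncoder (n : ℕ) : Matrix (Fin (2 * n)) (Fin n) ℂ :=
  sqrtSigma n * dftMatrix (2 * n) * embedMatrix n

theorem spectralEncoder_apply (n : ℕ) (k : Fin (2 * n)) (m : Fin n) :
    spectralEncoder n k m = Complex.sqrt (eig n k) *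
      (((√((2 * n : ℕ) : ℝ) : ℝ) : ℂ)⁻¹ * (zeta n ^ ((k : ℕ) * m))⁻¹) := by
  have hm : (m : ℕ) < 2 * n := by omega
  rw [spectralEncoder, mul_apply, sum_eq_single (⟨m, hm⟩ : Fin (2 * n))]
  · rw [sqrtSigma, diagonal_mul, dftMatrix_apply, dftVec_circVec]
    simp [embedMatrix]
  · intro i _ hi
    have : (i : ℕ) ≠ m := fun h => hi (Fin.ext h)
    simp [embedMatrix, this]
  · simp

theorem spectralEncoder_mulVec (n : ℕ) (x : ℕ → ℂ) (k : Fin (2 * n)) :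
    (spectralEncoder n *ᵥ fun m => x m) k = ((√((2 * n : ℕ) : ℝ) : ℝ) : ℂ)⁻¹ *
      (Complex.sqrt (eig n k) * ∑ a ∈ range n, x a * (zeta n ^ ((k : ℕ) * a))⁻¹) := by
  rw [mulVec, dotProduct, mul_sum, mul_sum, ← Fin.sum_univ_eq_sum_range (fun a =>
    ((√((2 * n : ℕ) : ℝ) : ℝ) : ℂ)⁻¹ * (Complex.sqrt (eig n k) *
      (x a * (zeta n ^ ((k : ℕ) * a))⁻¹)))]
  refine sum_congr rfl fun a _ => ?_
  rw [spectralEncoder_apply]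
  ring

theorem encoder_eq (n : ℕ) : encoder n = (dftMatrix (2 * n))ᴴ * spectralEncoder n := rfl

/-- The odd frequencies suffice: there `√λ ≠ 0`, and the odd transform is invertible. -/
theorem encoder_injective {n : ℕ} (hn : 0 < n) (v : Fin n → ℂ) (hv : encoder n *ᵥ v = 0) :
    v = 0 := by
  have h1 : spectralEncoder n *ᵥ v = 0 := by
    have := congrArg (fun w => dftMatrix (2 * n) *ᵥ w) hv
    simpa [encoder_eq, mulVec_mulVec, ← Matrix.mul_assoc, dftMatrix_mul_conjTranspose hn] using this
  set x : ℕ → ℂ := fun m => if h : m < n then v ⟨m, h⟩ else 0 with hx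
  have hvx : v = fun m : Fin n => x m := by funext m; simp [hx]
  have h2 (j : ℕ) (hj : j < n) : oddDFT n x j = 0 := by
    have h3 := congrFun h1 ⟨2 * j + 1, by omega⟩
    rw [hvx, spectralEncoder_mulVec] at h3
    simp only [Pi.zero_apply, mul_eq_zero, inv_eq_zero, Complex.ofReal_eq_zero] at h3
    have h4 : √((2 * n : ℕ) : ℝ) ≠ 0 := by positivity
    have h5 := left_ne_zero_of_mul_eq_one (sqrt_oddEig_mul_invSqrtEig hn (j := j))
    rw [eig_odd] at h3
    exact (h3.resolve_left h4).resolve_left h5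
  funext m
  have h3 := sum_oddDFT hn x m.2
  rw [sum_eq_zero fun j hj => by rw [h2 j (mem_range.1 hj), mul_zero]] at h3
  have h4 : (n : ℂ) ≠ 0 := by exact_mod_cast hn.ne'
  rw [hvx]
  exact (mul_eq_zero.1 h3.symm).resolve_left h4

theorem pinv_encoder_mulVec {n : ℕ} (hn : 0 < n) (b : ℕ → ℝ) :
    pinv (encoder n) *ᵥ (fun j : Fin (2 * n) => (b j : ℂ)) = fun m : Fin n => leastSquares n b m := by
  refine pinv_mulVec_eq (encoder_injective hn) ?_
  rw [encoder_eq, conjTranspose_mul, conjTranspose_conjTranspose, mulVec_mulVec,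
    Matrix.mul_assoc, ← Matrix.mul_assoc (dftMatrix (2 * n)), dftMatrix_mul_conjTranspose hn,
    Matrix.one_mul, ← mulVec_mulVec, ← mulVec_mulVec, ← sub_eq_zero, ← mulVec_sub]
  funext m
  have hF (k : Fin (2 * n)) : (dftMatrix (2 * n) *ᵥ fun j : Fin (2 * n) => (b j : ℂ)) k
      = ((√((2 * n : ℕ) : ℝ) : ℝ) : ℂ)⁻¹ *
        ∑ a ∈ range (2 * n), (b a : ℂ) * (zeta n ^ ((k : ℕ) * a))⁻¹ := by
    rw [mulVec, dotProduct, mul_sum, ← Fin.sum_univ_eq_sum_range (fun a =>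
      ((√((2 * n : ℕ) : ℝ) : ℝ) : ℂ)⁻¹ * ((b a : ℂ) * (zeta n ^ ((k : ℕ) * a))⁻¹))]
    refine sum_congr rfl fun a _ => ?_
    rw [dftMatrix_apply]
    ring
  have h := leastSquares_normal hn b m.2
  rw [← Fin.sum_univ_eq_sum_range (fun k => (starRingEnd ℂ) (Complex.sqrt (eig n k)) *
    zeta n ^ (k * m) * (Complex.sqrt (eig n k) *
      ∑ a ∈ range n, leastSquares n b a * (zeta n ^ (k * a))⁻¹
        - ∑ a ∈ range (2 * n), (b a : ℂ) * (zeta n ^ (k * a))⁻¹))] at h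
  -- Two normalizing factors `1 / √(2n)` occur, one from the adjoint and one from the residual; they
  -- are pulled out of the sum.
  rw [mulVec, dotProduct, Pi.zero_apply, ← mul_zero (((√((2 * n : ℕ) : ℝ) : ℝ) : ℂ)⁻¹ ^ 2), ← h,
    mul_sum]
  refine sum_congr rfl fun k _ => ?_
  rw [Pi.sub_apply, spectralEncoder_mulVec, hF, conjTranspose_apply, spectralEncoder_apply]
  simp only [star_mul', star_inv₀, RCLike.star_def, conj_zeta_pow, inv_inv, Complex.conj_ofReal]
  ring

/-- The program stores real parts only, so reality of the solution is what makes the result exact.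
-/
theorem decoded_eq_optDecoder {n : ℕ} (b : Fin (2 * n) → ℝ) (i : Fin n) :
    ((decoded n (inputState n b).rmem i : ℝ) : ℂ)
      = (optDecoder n *ᵥ fun j => ((b j : ℝ) : ℂ)) i := by
  have hn : 0 < n := i.pos
  set β := (inputState n b).rmem with hβ
  have hb : (fun j => ((b j : ℝ) : ℂ)) = fun j : Fin (2 * n) => ((β j : ℝ) : ℂ) := by
    funext j
    simp [hβ, inputState]
  rw [hb, optDecoder, ← mulVec_mulVec, pinv_encoder_mulVec hn]
  have hx : (prefixSum n *ᵥ fun m : Fin n => leastSquares n β m) i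
      = ∑ j ∈ range (i + 1), leastSquares n β j := by
    simp only [mulVec, dotProduct, prefixSum, of_apply]
    have : ∀ j : Fin n, (if j ≤ i then (1 : ℂ) else 0) * leastSquares n β j
        = (fun j : ℕ => if j ≤ i then leastSquares n β j else 0) j := by
      intro j
      by_cases h : j ≤ i
      · have h' : (j : ℕ) ≤ i := h
        simp [h]
      · have h' : ¬ (j : ℕ) ≤ i := h
        simp [h]
    rw [sum_congr rfl fun j _ => this j, Fin.sum_univ_eq_sum_range
      (fun j : ℕ => if j ≤ i then leastSquares n β j else 0), ← sum_filter]
    congr 1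
    ext j
    have := i.2
    simp
    omega
  have h1 : (starRingEnd ℂ) (∑ j ∈ range (i + 1), negacyclicSol n β j)
      = ∑ j ∈ range (i + 1), negacyclicSol n β j := by
    simp [conj_negacyclicSol hn]
  have h2 : (starRingEnd ℂ) (correctionCoeff n β * ∑ j ∈ range (i + 1), correction n j)
      = correctionCoeff n β * ∑ j ∈ range (i + 1), correction n j := by
    simp [conj_correctionCoeff hn, conj_correction]
  rw [hx, decoded, Complex.ofReal_add, Complex.conj_eq_iff_re.1 h1, Complex.conj_eq_iff_re.1 h2]
  simp only [leastSquares]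
  rw [sum_add_distrib, mul_sum]

/-! ### Running time -/

theorem decoderCost_le : ∃ C, ∀ n,
    decoderCost n ≤ C * ((Nat.clog 2 (3 * n) + 1) * 2 ^ Nat.clog 2 (3 * n)) := by
  obtain ⟨C, hC⟩ := polyMulCost_le
  refine ⟨(blockCost initOps + (sizeTest.cost + 1) + blockCost chirpInitOps
    + 2 * blockCost modulusOps + blockCost kernelInitOps + blockCost prefixInitOps
    + blockCost coeffOps + 2) + (sizeTest.cost + blockCost doubleOps + 1)
    + 2 * (forCost chirpOps + forCost kernelOps + forCost prefixOps + forCost correctOps)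
    + 2 * C, fun n => ?_⟩
  have hkn : 3 * n ≤ 2 ^ Nat.clog 2 (3 * n) := Nat.le_pow_clog (by norm_num) _
  rw [decoderCost]
  have hCk := hC (Nat.clog 2 (3 * n))
  generalize Nat.clog 2 (3 * n) = k at *
  generalize blockCost initOps + (sizeTest.cost + 1) + blockCost chirpInitOps
    + 2 * blockCost modulusOps + blockCost kernelInitOps + blockCost prefixInitOps
    + blockCost coeffOps + 2 = c₀
  generalize sizeTest.cost + blockCost doubleOps + 1 = c₁
  generalize forCost chirpOps + forCost kernelOps + forCost prefixOps + forCost correctOps = c₂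
  have h1 : 1 ≤ 2 ^ k := Nat.one_le_two_pow
  generalize 2 ^ k = m at *
  have h2 : m ≤ (k + 1) * m := Nat.le_mul_of_pos_left _ (by omega)
  have h3 : k ≤ (k + 1) * m := by nlinarith
  have h4 : n + 1 ≤ 2 * ((k + 1) * m) := by omega
  calc c₀ + k * c₁ + (n + 1) * c₂ + 2 * polyMulCost k
      ≤ c₀ * ((k + 1) * m) + ((k + 1) * m) * c₁ + (2 * ((k + 1) * m)) * c₂
        + 2 * (C * ((k + 1) * m)) := by
        gcongr
        exact Nat.le_mul_of_pos_right _ (by omega)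
    _ = _ := by ring

theorem clog_mul_pow_isBigO :
    (fun n : ℕ => (((Nat.clog 2 (3 * n) + 1) * 2 ^ Nat.clog 2 (3 * n) : ℕ) : ℝ))
      =O[Filter.atTop] fun n : ℕ => (n : ℝ) * Real.log n ^ 2 := by
  have hl2 : 0 < Real.log 2 := Real.log_pos one_lt_two
  -- From `2 ^ k ≤ 6n` and `(k + 1) log 2 ≤ 2 log n`; the latter holds once `2 ^ (k + 1) ≤ 12n ≤
  -- n²`, hence the threshold `12`.
  refine Asymptotics.IsBigO.of_bound (12 / Real.log 2) ?_
  filter_upwards [Filter.eventually_ge_atTop 12] with n hn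
  set k := Nat.clog 2 (3 * n)
  have hn' : (12 : ℝ) ≤ n := by exact_mod_cast hn
  have hpk : 2 ^ k ≤ 6 * n := by
    have h1 := Nat.pow_pred_clog_lt_self (b := 2) one_lt_two (x := 3 * n) (by omega)
    have h2 : 0 < k := Nat.clog_pos one_lt_two (by omega)
    have h3 : 2 ^ k = 2 * 2 ^ (k - 1) := by rw [← pow_succ', Nat.sub_add_cancel h2]
    change 2 ^ (k - 1) < 3 * n at h1
    omega
  have hlog1 : 1 ≤ Real.log n := by
    rw [Real.le_log_iff_exp_le (by linarith)]
    linarith [Real.exp_one_lt_d9]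
  have hk : (k + 1 : ℝ) * Real.log 2 ≤ 2 * Real.log n := by
    have h1 : ((2 : ℝ) ^ (k + 1)) ≤ (n : ℝ) ^ 2 := by
      have : 2 ^ (k + 1) ≤ n ^ 2 := by rw [pow_succ]; nlinarith
      exact_mod_cast this
    have h2 := Real.log_le_log (by positivity) h1
    rw [Real.log_pow, Real.log_pow] at h2
    exact_mod_cast h2
  have hpk' : ((2 : ℝ) ^ k) ≤ 6 * n := by exact_mod_cast hpk
  rw [Real.norm_of_nonneg (by positivity), Real.norm_of_nonneg (by positivity)]
  push_cast
  rw [div_mul_eq_mul_div, le_div_iff₀ hl2]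
  calc ((k : ℝ) + 1) * 2 ^ k * Real.log 2 = ((k + 1 : ℝ) * Real.log 2) * 2 ^ k := by ring
    _ ≤ (2 * Real.log n) * (6 * n) := by gcongr
    _ = 12 * (n * (Real.log n * 1)) := by ring
    -- The bound so far is `O(n log n)`; the second logarithm is given away here.
    _ ≤ 12 * (n * (Real.log n * Real.log n)) := by gcongr
    _ = 12 * (n * Real.log n ^ 2) := by ring

end RealRAM

theorem mainTheorem11 :
    ∃ (P : RealRAM.Program) (T : ℕ → ℕ),
      (∀ (n : ℕ) (b : Fin (2 * n) → ℝ), ∃ (t : ℕ) (s : RealRAM.State),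
        P.HaltsIn (RealRAM.inputState n b) t s ∧ t ≤ T n ∧
          ∀ i : Fin n, ((s.rmem i : ℝ) : ℂ) =
            (FFTMech.optDecoder n *ᵥ fun j => ((b j : ℝ) : ℂ)) i) ∧
      (fun n : ℕ => (T n : ℝ)) =O[Filter.atTop] (fun n : ℕ => (n : ℝ) * Real.log n ^ 2) := by
  obtain ⟨C, hC⟩ := RealRAM.decoderCost_le
  refine ⟨RealRAM.decoderProgram,
    fun n => C * ((Nat.clog 2 (3 * n) + 1) * 2 ^ Nat.clog 2 (3 * n)), fun n b => ?_, ?_⟩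
  · obtain ⟨s, ⟨t, ht, hs⟩, hv⟩ := RealRAM.decoderProgram_runs n b
    exact ⟨t, s, hs, ht.trans (hC n), fun i => by
      rw [hv i i.2, RealRAM.decoded_eq_optDecoder]⟩
  · simp only [Nat.cast_mul C]
    exact RealRAM.clog_mul_pow_isBigO.const_mul_left _
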